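/- Fix $\gamma>1/2$ and $z\in\mathbb C$. Let $(M_N)_{N\ge1}$ be deterministic complex $N\times N$ matrices and let $G_N$ be $N\times N$ complex Ginibre matrices (i.i.d. standard complex Gaussian entries, $\mathbb E|g|^2=1$), defined on a common probability space. Let $\Sigma_N(z)=\operatorname{diag}(\Sigma_{11}(z),\dots,\Sigma_{NN}(z))$ be the diagonal matrix of the singular values of $M_N-z\,\mathrm{Id}$, arranged so that $\Sigma_{11}(z)\le\cdots\le\Sigma_{NN}(z)$. Let $\varepsilon_N>0$ with $\varepsilon_N\to0$, and let $N^*$ be the largest integer $i\in\{1,\dots,N\}$ such that $$\Sigma_{ii}(z)<\varepsilon_N^{-1}N^{-\gamma}(N-i+1)^{1/2}.$$ For those $N$ for which no such $i$ exists, put $N^*=0$. Alternatively, for all those $N$ one may put $N^*=1$, provided that $\frac1N\max\{0,\log\Sigma_{11}(z)\}\to0$ as $N\to\infty$. Let $B_N(z)$ be the lower right $(N-N^*)\times(N-N^*)$ block of $\Sigma_N(z)$. Suppose that $N^*\log N/N\to\alpha<\infty$, and that either $\log(\varepsilon_N^{-1})/\log N\to0$, or $\alpha=0$ and $\varepsilon_N=N^{-\eta}$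 for some $\eta>0$. Then $\det B_N(z)\ne0$ and, almost surely, $\det(\Sigma_N(z)+N^{-\gamma}G_N)\neq0$, and $$\frac1N\log\bigl|\det(\Sigma_N(z)+N^{-\gamma}G_N)\bigr|-\frac1N\log\bigl|\det B_N(z)\bigr|\longrightarrow-\alpha\bigl(\gamma-\tfrac12\bigr)$$ in probability as $N\to\infty$. (The determinant of an empty block is $1$.) -/

import Mathlib

open MeasureTheory ProbabilityTheory Filter Topology

namespace NoisyLogDet

noncomputable section

/-- The law of a standard complex Gaussian variable `g`: real and imaginary parts are independent,
centred, real Gaussian of variance `1/2`, so that `𝔼 g = 0`, `𝔼 g² = 0` and `𝔼 |g|² = 1`. -/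
def stdComplexGaussian : Measure ℂ :=
  ((gaussianReal 0 (1 / 2)).prod (gaussianReal 0 (1 / 2))).map
    (fun p : ℝ × ℝ => (p.1 : ℂ) + (p.2 : ℂ) * Complex.I)

/-- `G` is an `N × N` complex Ginibre matrix: its entries are i.i.d. standard complex Gaussian. -/
structure IsGinibre {Ω : Type*} [MeasurableSpace Ω] (P : Measure Ω) {N : ℕ}
    (G : Ω → Matrix (Fin N) (Fin N) ℂ) : Prop where
  hasLaw : ∀ i j, HasLaw (fun ω => G ω i j) stdComplexGaussian P
  indep : iIndepFun (fun (p : Fin N × Fin N) ω => G ω p.1 p.2) P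

/-- `sigmaUp A k`, for `1 ≤ k ≤ N`, is the `k`-th smallest singular value of `A` (with
multiplicity), i.e. the `(N - k + 1)`-th largest one. (Mathlib's `singularValues` is
non-increasing and indexed from `0`.) -/
def sigmaUp {N : ℕ} (A : Matrix (Fin N) (Fin N) ℂ) (k : ℕ) : ℝ :=
  (Matrix.toEuclideanLin A).singularValues (N - k)

/-- The diagonal matrix of the singular values of `A`, non-decreasing down the diagonal. -/
def sigmaMatrix {N : ℕ} (A : Matrix (Fin N) (Fin N) ℂ) : Matrix (Fin N) (Fin N) ℂ :=
  Matrix.diagonal fun i => (sigmaUp A (i.val + 1) : ℂ)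

/-- The indices `1 ≤ i ≤ N` such that the `i`-th smallest singular value of `A` is less than
`ε⁻¹ N ^ (-γ) (N - i + 1) ^ (1/2)`. -/
def smallIndices {N : ℕ} (A : Matrix (Fin N) (Fin N) ℂ) (γ ε : ℝ) : Finset ℕ :=
  (Finset.Icc 1 N).filter fun i =>
    sigmaUp A i < ε⁻¹ * (N : ℝ) ^ (-γ) * √((N : ℝ) - (i : ℝ) + 1)

/-- The truncation index `N*`: the largest element of `smallIndices A γ ε`, or the default value
`d` if there is none. -/
def truncIndex {N : ℕ} (A : Matrix (Fin N) (Fin N) ℂ) (γ ε : ℝ) (d : ℕ) : ℕ :=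
  if h : (smallIndices A γ ε).Nonempty then (smallIndices A γ ε).max' h else d

/-- The lower right diagonal block of `sigmaMatrix A` that is left after the first `n` rows and
columns are removed (`i : Fin N` is the `(i + 1)`-st index, so the block consists of `n ≤ i`). -/
def largeBlock {N : ℕ} (A : Matrix (Fin N) (Fin N) ℂ) (n : ℕ) :
    Matrix {i : Fin N // n ≤ i.val} {i : Fin N // n ≤ i.val} ℂ :=
  (sigmaMatrix A).submatrix Subtype.val Subtype.val

/-- The noisy matrix `Σ + N ^ (-γ) G`, where `Σ = sigmaMatrix A`. -/
def noisySigma {N : ℕ} (A : Matrix (Fin N) (Fin N) ℂ) (γ : ℝ) (G : Matrix (Fin N) (Fin N) ℂ) :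
    Matrix (Fin N) (Fin N) ℂ :=
  sigmaMatrix A + (((N : ℝ) ^ (-γ) : ℝ) : ℂ) • G

end

end NoisyLogDet

/-! Write $s=N^{-\gamma}$, $n=N^*$, $D=\det(\Sigma+sG)$, $Y=\log|D|-\log\det B$ and
$c=-\alpha(\gamma-\frac12)$. The proof bounds $\mathbb E\,Y$ from below and an exponential moment of
$Y$ from above; the two agree to order $o(N)$, which forces $Y/N\to c$ in $L^1$.

Upper bound. Rows are independent and $\Sigma$ is diagonal, so $\mathbb E|D|^2$ is the permanent of
$\operatorname{diag}(\sigma_i^2)+s^2J$, with $J$ the all-ones matrix. It is at most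
$\prod_i(\sigma_i^2+s^2(N-i+1))$ (`sum_perm_prod_le`). Beyond $N^*$ the threshold makes the noise
part at most $\varepsilon^2\sigma_i^2$, a factor $e^{\varepsilon^2}$; up to $N^*$ each factor is at
most $N^{1-2\gamma}(1+\varepsilon^{-2})$. Hence $\mathbb E\,e^{2Y}\le e^V$ with $V/(2N)\to c$
(`prod_le_exp_momentExponent`).

Lower bound. Given all rows but one, $D=b+\sum_j a_jx_j$ is affine in a Gaussian row, distributed as
$b+wg$ with $w=\|a\|_2$. If $b\ne0$, then $\mathbb E\log|b+wg|\ge\log|b|$ because $\log|\cdot|$ is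
subharmonic and $g$ is rotation invariant; this removes the rows beyond $N^*$ one by one, each
leaving $\log\sigma_i$. Always $\mathbb E\log|b+wg|\ge\log w-K$; with concavity of the logarithm
applied to the minors, the remaining $n\times n$ block contributes at least $n\log s+\frac12\log
n!-Kn$. Divided by $N$, this tends to $-\gamma\alpha+\frac12\alpha=c$.

Conclusion. From $|t|\le e^{2t}-t$ with $t=Y-V/2$, a bound $\mathbb E\,Y\ge U$ gives $\mathbb
E|Y-V/2|\le1+V/2-U=o(N)$. -/

namespace NoisyLogDet

/-! ### The standard complex Gaussian law -/

lemma posLog_eq_max (x : ℝ) : Real.posLog x = max 0 (Real.log x) := rfl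

lemma posLog_le_abs (x : ℝ) : Real.posLog x ≤ |x| := by
  rw [posLog_eq_max]
  refine max_le (abs_nonneg _) ?_
  rw [← Real.log_abs]
  rcases (abs_nonneg x).eq_or_lt with h | h
  · simp [← h]
  · linarith [Real.log_le_sub_one_of_pos h]

lemma measurable_posLog_real : Measurable Real.posLog := by
  have : Real.posLog = fun x => max 0 (Real.log x) := by
    ext x; rw [posLog_eq_max]
  rw [this]
  exact measurable_const.max Real.measurable_log

lemma measurable_posLog_comp {α : Type*} [MeasurableSpace α] {f : α → ℝ}
    (hf : Measurable f) : Measurable fun x => Real.posLog (f x) :=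
  measurable_posLog_real.comp hf

lemma lintegral_posLog_abs_inv_lt_top :
    ∫⁻ x : ℝ, ENNReal.ofReal (Real.posLog |x|⁻¹) < ⊤ := by
  have h1 : IntegrableOn Real.log (Set.Icc (-1) 1) := by
    have := intervalIntegral.intervalIntegrable_log' (a := -1) (b := 1)
    rwa [intervalIntegrable_iff_integrableOn_Icc_of_le (by norm_num)] at this
  have h2 : Integrable (fun x => (Set.Icc (-1 : ℝ) 1).indicator (fun x => |Real.log x|) x) := by
    rw [integrable_indicator_iff measurableSet_Icc]
    exact h1.abs
  refine lt_of_le_of_lt (lintegral_mono fun x => ENNReal.ofReal_le_ofReal ?_) h2.lintegral_lt_top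
  by_cases hx : x ∈ Set.Icc (-1 : ℝ) 1
  · rw [Set.indicator_of_mem hx, posLog_eq_max, Real.log_inv, Real.log_abs]
    exact max_le (abs_nonneg _) (neg_le_abs _)
  · rw [Set.indicator_of_notMem hx]
    refine le_of_eq ?_
    rw [Real.posLog_eq_zero_iff, abs_inv, abs_abs]
    apply inv_le_one_of_one_le₀
    by_contra! h
    exact hx (abs_le.1 h.le)

lemma gaussianPDF_half_le_one (x : ℝ) : gaussianPDF 0 (1 / 2) x ≤ 1 := by
  rw [gaussianPDF, ← ENNReal.ofReal_one]
  apply ENNReal.ofReal_le_ofReal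
  rw [gaussianPDFReal]
  have h1 : (√(2 * Real.pi * ((1 / 2 : NNReal) : ℝ)))⁻¹ ≤ 1 := by
    apply inv_le_one_of_one_le₀
    rw [Real.one_le_sqrt]
    push_cast
    linarith [Real.pi_gt_three]
  have h2 : Real.exp (-(x - 0) ^ 2 / (2 * ((1 / 2 : NNReal) : ℝ))) ≤ 1 := by
    rw [Real.exp_le_one_iff]
    push_cast
    nlinarith [sq_nonneg x]
  exact mul_le_one₀ h1 (Real.exp_pos _).le h2

/-- The density is at most 1, so Lebesgue measure dominates the Gaussian; translation invariance
then makes the bound independent of the shift `β`. -/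
lemma exists_lintegral_posLog_inv_gaussianReal_le : ∃ K : ℝ, 0 ≤ K ∧ ∀ β : ℝ,
    ∫⁻ x, ENNReal.ofReal (Real.posLog |β + x|⁻¹) ∂(gaussianReal 0 (1 / 2)) ≤
      ENNReal.ofReal K := by
  refine ⟨(∫⁻ x : ℝ, ENNReal.ofReal (Real.posLog |x|⁻¹)).toReal, ENNReal.toReal_nonneg, ?_⟩
  intro β
  rw [ENNReal.ofReal_toReal lintegral_posLog_abs_inv_lt_top.ne,
    gaussianReal_of_var_ne_zero _ (by norm_num),
    lintegral_withDensity_eq_lintegral_mul _ (measurable_gaussianPDF _ _)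
      (measurable_posLog_comp (f := fun x : ℝ => |β + x|⁻¹) (by fun_prop)).ennreal_ofReal]
  rw [← lintegral_add_left_eq_self (fun x : ℝ => ENNReal.ofReal (Real.posLog |x|⁻¹)) β]
  refine lintegral_mono fun x => ?_
  exact mul_le_of_le_one_left zero_le (gaussianPDF_half_le_one x)

instance : IsProbabilityMeasure stdComplexGaussian := by
  unfold stdComplexGaussian
  exact Measure.isProbabilityMeasure_map (by fun_prop)

lemma map_re_stdComplexGaussian :
    stdComplexGaussian.map Complex.re = gaussianReal 0 (1 / 2) := by
  rw [stdComplexGaussian, Measure.map_map (by fun_prop) (by fun_prop)]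
  have : (Complex.re ∘ fun p : ℝ × ℝ => (p.1 : ℂ) + (p.2 : ℂ) * Complex.I) = Prod.fst := by
    ext p; simp
  rw [this, Measure.map_fst_prod]
  simp

lemma map_im_stdComplexGaussian :
    stdComplexGaussian.map Complex.im = gaussianReal 0 (1 / 2) := by
  rw [stdComplexGaussian, Measure.map_map (by fun_prop) (by fun_prop)]
  have : (Complex.im ∘ fun p : ℝ × ℝ => (p.1 : ℂ) + (p.2 : ℂ) * Complex.I) = Prod.snd := by
    ext p; simp
  rw [this, Measure.map_snd_prod]
  simp

lemma charFun_stdComplexGaussian (t : ℂ) :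
    charFun stdComplexGaussian t = Complex.exp (-(‖t‖ ^ 2 / 4 : ℝ)) := by
  rw [charFun_apply, stdComplexGaussian, integral_map (by fun_prop)
    (Continuous.aestronglyMeasurable (by fun_prop))]
  have h : ∀ p : ℝ × ℝ, Complex.exp
      ((inner ℝ ((p.1 : ℂ) + (p.2 : ℂ) * Complex.I) t : ℝ) * Complex.I) =
      Complex.exp ((inner ℝ p.1 t.re : ℝ) * Complex.I) *
        Complex.exp ((inner ℝ p.2 t.im : ℝ) * Complex.I) := by
    intro p
    rw [← Complex.exp_add]
    congr 1
    simp [Complex.inner]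
    ring
  simp_rw [h]
  rw [integral_prod_mul (fun x : ℝ => Complex.exp ((inner ℝ x t.re : ℝ) * Complex.I))
    (fun x : ℝ => Complex.exp ((inner ℝ x t.im : ℝ) * Complex.I)), ← charFun_apply,
    ← charFun_apply, charFun_gaussianReal, charFun_gaussianReal, ← Complex.exp_add]
  congr 1
  rw [← Complex.normSq_eq_norm_sq, Complex.normSq_apply]
  push_cast
  ring

lemma inner_mul_left_complex (a x t : ℂ) :
    (inner ℝ (a * x) t : ℝ) = inner ℝ x (starRingEnd ℂ a * t) := by
  simp [Complex.inner]
  ring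

lemma charFun_map_mul_stdComplexGaussian (a t : ℂ) :
    charFun (stdComplexGaussian.map (a * ·)) t =
      Complex.exp (-(‖a‖ ^ 2 * ‖t‖ ^ 2 / 4 : ℝ)) := by
  rw [charFun_apply, integral_map (by fun_prop)
    (Continuous.aestronglyMeasurable (by fun_prop))]
  simp_rw [inner_mul_left_complex]
  rw [← charFun_apply, charFun_stdComplexGaussian]
  simp [mul_pow]

/-- A linear combination of i.i.d. standard complex Gaussians is a multiple of a single one. -/
lemma map_sum_mul_pi_stdComplexGaussian {ι : Type*} [Fintype ι] (a : ι → ℂ) (w : ℝ)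
    (hw : w ^ 2 = ∑ j, ‖a j‖ ^ 2) :
    (Measure.pi fun _ : ι => stdComplexGaussian).map (fun x => ∑ j, a j * x j) =
      stdComplexGaussian.map ((w : ℂ) * ·) := by
  have hm : Measurable fun x : ι → ℂ => ∑ j, a j * x j := by fun_prop
  have : IsProbabilityMeasure
      ((Measure.pi fun _ : ι => stdComplexGaussian).map (fun x => ∑ j, a j * x j)) :=
    Measure.isProbabilityMeasure_map hm.aemeasurable
  have : IsProbabilityMeasure (stdComplexGaussian.map ((w : ℂ) * ·)) :=
    Measure.isProbabilityMeasure_map (by fun_prop)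
  refine Measure.ext_of_charFun ?_
  ext t
  rw [charFun_map_mul_stdComplexGaussian, charFun_apply, integral_map hm.aemeasurable
    (Continuous.aestronglyMeasurable (by fun_prop))]
  have h : ∀ x : ι → ℂ, Complex.exp ((inner ℝ (∑ j, a j * x j) t : ℝ) * Complex.I) =
      ∏ j, Complex.exp ((inner ℝ (x j) (starRingEnd ℂ (a j) * t) : ℝ) * Complex.I) := by
    intro x
    rw [← Complex.exp_sum, sum_inner, Complex.ofReal_sum, Finset.sum_mul]
    simp_rw [inner_mul_left_complex]
  simp_rw [h]
  rw [integral_fintype_prod_eq_prod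
    (fun j (y : ℂ) => Complex.exp ((inner ℝ y (starRingEnd ℂ (a j) * t) : ℝ) * Complex.I))]
  simp_rw [← charFun_apply, charFun_stdComplexGaussian]
  rw [← Complex.exp_sum]
  congr 1
  simp only [norm_mul, RCLike.norm_conj, mul_pow, Complex.norm_real, Real.norm_eq_abs, sq_abs]
  rw [hw, Finset.sum_neg_distrib, ← Complex.ofReal_sum, Finset.sum_mul, Finset.sum_div]

lemma map_mul_stdComplexGaussian_of_norm_eq_one {c : ℂ} (hc : ‖c‖ = 1) :
    stdComplexGaussian.map (c * ·) = stdComplexGaussian := by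
  have : IsProbabilityMeasure (stdComplexGaussian.map (c * ·)) :=
    Measure.isProbabilityMeasure_map (by fun_prop)
  refine Measure.ext_of_charFun ?_
  ext t
  rw [charFun_map_mul_stdComplexGaussian, charFun_stdComplexGaussian, hc]
  simp

lemma stdComplexGaussian_singleton (c : ℂ) : stdComplexGaussian {c} = 0 := by
  have h1 : ({c} : Set ℂ) ⊆ Complex.re ⁻¹' {c.re} := by
    rintro x rfl; simp
  refine measure_mono_null h1 ?_
  rw [← Measure.map_apply (by fun_prop) (measurableSet_singleton _), map_re_stdComplexGaussian]
  have := nullSingletonClass_gaussianReal (μ := 0) (v := 1 / 2) (by norm_num)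
  exact measure_singleton _

lemma ae_add_mul_ne_zero (b : ℂ) {w : ℂ} (hw : w ≠ 0) :
    ∀ᵐ x ∂stdComplexGaussian, b + w * x ≠ 0 := by
  rw [ae_iff]
  refine measure_mono_null ?_ (stdComplexGaussian_singleton (-b / w))
  intro x hx
  simp only [ne_eq, not_not, Set.mem_ofPred_eq] at hx
  rw [Set.mem_singleton_iff, eq_div_iff hw]
  linear_combination hx

lemma memLp_two_stdComplexGaussian : MemLp (fun x : ℂ => x) 2 stdComplexGaussian := by
  have h1 : MemLp Complex.re 2 stdComplexGaussian := by
    have := memLp_id_gaussianReal (μ := 0) (v := 1 / 2) 2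
    rw [← map_re_stdComplexGaussian] at this
    exact this.comp_of_map (by fun_prop)
  have h2 : MemLp Complex.im 2 stdComplexGaussian := by
    have := memLp_id_gaussianReal (μ := 0) (v := 1 / 2) 2
    rw [← map_im_stdComplexGaussian] at this
    exact this.comp_of_map (by fun_prop)
  have h3 : MemLp (fun x : ℂ => ‖x.re‖ + ‖x.im‖) 2 stdComplexGaussian := h1.norm.add h2.norm
  refine h3.mono (by fun_prop) (ae_of_all _ fun x => ?_)
  rw [Real.norm_of_nonneg (by positivity)]
  exact Complex.norm_le_abs_re_add_abs_im x

lemma integrable_id_stdComplexGaussian : Integrable (fun x : ℂ => x) stdComplexGaussian :=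
  memLp_two_stdComplexGaussian.integrable (by norm_num)

lemma integral_id_stdComplexGaussian : ∫ x, x ∂stdComplexGaussian = 0 := by
  have h := integral_map (μ := stdComplexGaussian) (φ := fun x : ℂ => (-1) * x)
    (f := fun x : ℂ => x) (by fun_prop) (by fun_prop)
  rw [map_mul_stdComplexGaussian_of_norm_eq_one (by simp)] at h
  simp only [neg_mul, one_mul] at h
  exact self_eq_neg.1 (h.trans (integral_neg _))

lemma integral_norm_sq_stdComplexGaussian : ∫ x, ‖x‖ ^ 2 ∂stdComplexGaussian = 1 := by
  have hg : Integrable (fun x : ℝ => x ^ 2) (gaussianReal 0 (1 / 2)) :=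
    (memLp_id_gaussianReal (μ := 0) (v := 1 / 2) 2).integrable_sq
  have hv : ∫ x, x ^ 2 ∂(gaussianReal 0 (1 / 2)) = 1 / 2 := by
    have h := variance_id_gaussianReal (μ := 0) (v := 1 / 2)
    rw [variance_of_integral_eq_zero (by fun_prop) (by simp)] at h
    simpa using h
  have h1 : Integrable (fun x : ℂ => x.re ^ 2) stdComplexGaussian := by
    rw [← map_re_stdComplexGaussian] at hg
    exact hg.comp_measurable (by fun_prop)
  have h2 : Integrable (fun x : ℂ => x.im ^ 2) stdComplexGaussian := by
    rw [← map_im_stdComplexGaussian] at hg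
    exact hg.comp_measurable (by fun_prop)
  have h3 : ∫ x : ℂ, x.re ^ 2 ∂stdComplexGaussian = 1 / 2 := by
    rw [← hv, ← map_re_stdComplexGaussian, integral_map (by fun_prop) (by fun_prop)]
  have h4 : ∫ x : ℂ, x.im ^ 2 ∂stdComplexGaussian = 1 / 2 := by
    rw [← hv, ← map_im_stdComplexGaussian, integral_map (by fun_prop) (by fun_prop)]
  have h5 : ∀ x : ℂ, ‖x‖ ^ 2 = x.re ^ 2 + x.im ^ 2 := by
    intro x
    rw [← Complex.normSq_eq_norm_sq, Complex.normSq_apply]; ring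
  simp_rw [h5]
  rw [integral_add h1 h2, h3, h4]
  norm_num

/-! ### Logarithmic integrals of affine functions of a Gaussian -/

/-- Since $|b+x|\ge|\operatorname{Re}(b+x)|$, the real case suffices. -/
lemma exists_lintegral_posLog_inv_le : ∃ K : ℝ, 0 ≤ K ∧ ∀ b : ℂ,
    ∫⁻ x, ENNReal.ofReal (Real.posLog ‖b + x‖⁻¹) ∂stdComplexGaussian ≤ ENNReal.ofReal K := by
  obtain ⟨K, hK0, hK⟩ := exists_lintegral_posLog_inv_gaussianReal_le
  refine ⟨K, hK0, fun b => ?_⟩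
  refine le_trans ?_ (hK b.re)
  rw [← map_re_stdComplexGaussian, lintegral_map
    (measurable_posLog_comp (f := fun x : ℝ => |b.re + x|⁻¹) (by fun_prop)).ennreal_ofReal (by fun_prop)]
  refine lintegral_mono_ae ?_
  -- A vanishing real part must be excluded: with `0⁻¹ = 0` the comparison of inverses would fail
  -- there.
  have h0 : ∀ᵐ x ∂stdComplexGaussian, b.re + x.re ≠ 0 := by
    rw [ae_iff]
    have := nullSingletonClass_gaussianReal (μ := 0) (v := 1 / 2) (by norm_num)
    have h2 := measure_singleton (μ := gaussianReal 0 (1 / 2)) (-b.re)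
    rw [← map_re_stdComplexGaussian, Measure.map_apply (by fun_prop)
      (measurableSet_singleton _)] at h2
    refine measure_mono_null ?_ h2
    intro x hx
    simp only [ne_eq, not_not, Set.mem_ofPred_eq] at hx
    simp only [Set.mem_preimage, Set.mem_singleton_iff]
    linarith
  filter_upwards [h0] with x hx
  refine ENNReal.ofReal_le_ofReal (Real.posLog_le_posLog (by positivity) ?_)
  have hx' : 0 < |b.re + x.re| := abs_pos.2 hx
  refine inv_anti₀ hx' ?_
  simpa using Complex.abs_re_le_norm (b + x)

/-- A uniform bound for the integrals of `log⁻ ‖b + x‖` against the Gaussian law. -/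
noncomputable def negLogBound : ℝ := exists_lintegral_posLog_inv_le.choose

lemma negLogBound_nonneg : 0 ≤ negLogBound := exists_lintegral_posLog_inv_le.choose_spec.1

lemma lintegral_posLog_inv_le (b : ℂ) :
    ∫⁻ x, ENNReal.ofReal (Real.posLog ‖b + x‖⁻¹) ∂stdComplexGaussian ≤
      ENNReal.ofReal negLogBound :=
  exists_lintegral_posLog_inv_le.choose_spec.2 b

lemma measurable_posLog_norm_inv {α : Type*} [MeasurableSpace α] {f : α → ℂ}
    (hf : Measurable f) : Measurable fun x => Real.posLog ‖f x‖⁻¹ :=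
  measurable_posLog_real.comp hf.norm.inv

lemma integrable_posLog_inv (b : ℂ) :
    Integrable (fun x => Real.posLog ‖b + x‖⁻¹) stdComplexGaussian := by
  rw [← lintegral_ofReal_ne_top_iff_integrable
    (measurable_posLog_norm_inv (by fun_prop)).aestronglyMeasurable
    (ae_of_all _ fun x => Real.posLog_nonneg)]
  exact ((lintegral_posLog_inv_le b).trans_lt ENNReal.ofReal_lt_top).ne

lemma integral_posLog_inv_le (b : ℂ) :
    ∫ x, Real.posLog ‖b + x‖⁻¹ ∂stdComplexGaussian ≤ negLogBound := by
  rw [integral_eq_lintegral_of_nonneg_ae (ae_of_all _ fun x => Real.posLog_nonneg)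
    (measurable_posLog_norm_inv (by fun_prop)).aestronglyMeasurable]
  exact ENNReal.toReal_le_of_le_ofReal negLogBound_nonneg (lintegral_posLog_inv_le b)

lemma log_eq_posLog_sub_posLog_inv (x : ℝ) :
    Real.log x = Real.posLog x - Real.posLog x⁻¹ := Real.posLog_sub_posLog_inv.symm

lemma norm_add_mul_eq (b : ℂ) {w : ℝ} (hw : 0 < w) (x : ℂ) :
    ‖b + w * x‖ = w * ‖b / w + x‖ := by
  have hw' : (w : ℂ) ≠ 0 := by exact_mod_cast hw.ne'
  have : b + w * x = w * (b / w + x) := by field_simp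
  rw [this, norm_mul, Complex.norm_real, Real.norm_of_nonneg hw.le]

lemma integrable_log_norm_of_posLog_inv {α : Type*} [MeasurableSpace α] {ρ : Measure α}
    {f : α → ℂ} (hfm : Measurable f) (hf : Integrable f ρ)
    (h : ∫⁻ x, ENNReal.ofReal (Real.posLog ‖f x‖⁻¹) ∂ρ ≠ ⊤) :
    Integrable (fun x => Real.log ‖f x‖) ρ := by
  simp_rw [log_eq_posLog_sub_posLog_inv]
  refine Integrable.sub ?_ ?_
  · refine hf.norm.mono' (measurable_posLog_real.comp hfm.norm).aestronglyMeasurable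
      (ae_of_all _ fun x => ?_)
    rw [Real.norm_of_nonneg Real.posLog_nonneg]
    simpa using posLog_le_abs ‖f x‖
  · rwa [← lintegral_ofReal_ne_top_iff_integrable
      (measurable_posLog_norm_inv hfm).aestronglyMeasurable
      (ae_of_all _ fun x => Real.posLog_nonneg)]

lemma lintegral_posLog_inv_affine_le (b : ℂ) {w : ℝ} (hw : 0 < w) :
    ∫⁻ x, ENNReal.ofReal (Real.posLog ‖b + w * x‖⁻¹) ∂stdComplexGaussian ≤
      ENNReal.ofReal negLogBound + ENNReal.ofReal (Real.posLog w⁻¹) := by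
  have h1 : ∀ x : ℂ, ENNReal.ofReal (Real.posLog ‖b + w * x‖⁻¹) ≤
      ENNReal.ofReal (Real.posLog ‖b / w + x‖⁻¹) + ENNReal.ofReal (Real.posLog w⁻¹) := by
    intro x
    rw [← ENNReal.ofReal_add Real.posLog_nonneg Real.posLog_nonneg, norm_add_mul_eq b hw,
      mul_inv, mul_comm]
    exact ENNReal.ofReal_le_ofReal Real.posLog_mul
  refine (lintegral_mono h1).trans ?_
  rw [lintegral_add_right _ measurable_const, lintegral_const, measure_univ, mul_one]
  gcongr
  exact lintegral_posLog_inv_le _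

lemma integrable_log_norm_affine (b : ℂ) {w : ℝ} (hw : 0 < w) :
    Integrable (fun x : ℂ => Real.log ‖b + w * x‖) stdComplexGaussian := by
  refine integrable_log_norm_of_posLog_inv (by fun_prop)
    ((integrable_const b).add (integrable_id_stdComplexGaussian.const_mul _)) ?_
  exact ((lintegral_posLog_inv_affine_le b hw).trans_lt (by simp)).ne

lemma log_sub_le_integral_log_norm_affine (b : ℂ) {w : ℝ} (hw : 0 < w) :
    Real.log w - negLogBound ≤ ∫ x, Real.log ‖b + w * x‖ ∂stdComplexGaussian := by
  have h1 : ∫ x, (Real.log w - Real.posLog ‖b / w + x‖⁻¹) ∂stdComplexGaussian ≤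
      ∫ x, Real.log ‖b + w * x‖ ∂stdComplexGaussian := by
    refine integral_mono_ae ((integrable_const _).sub (integrable_posLog_inv _))
      (integrable_log_norm_affine b hw) ?_
    filter_upwards [ae_add_mul_ne_zero (b / w) one_ne_zero] with x hx
    rw [one_mul] at hx
    rw [norm_add_mul_eq b hw, Real.log_mul hw.ne' (norm_ne_zero_iff.2 hx),
      log_eq_posLog_sub_posLog_inv ‖b / w + x‖]
    linarith [Real.posLog_nonneg (x := ‖b / (w : ℂ) + x‖)]
  rw [integral_sub (integrable_const _) (integrable_posLog_inv _)] at h1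
  simp only [integral_const, probReal_univ, one_smul] at h1
  linarith [integral_posLog_inv_le (b / w)]

lemma integral_comp_mul_of_norm_eq_one {c : ℂ} (hc : ‖c‖ = 1) {f : ℂ → ℝ}
    (hf : Measurable f) :
    ∫ x, f (c * x) ∂stdComplexGaussian = ∫ x, f x ∂stdComplexGaussian := by
  conv_rhs => rw [← map_mul_stdComplexGaussian_of_norm_eq_one hc]
  rw [integral_map (by fun_prop) hf.aestronglyMeasurable]

/-- Multiplying by $e^{-i\theta}$ moves the phase of the centre onto the Gaussian variable, whose
law does not see it. -/
lemma exists_norm_eq_one_norm_circleMap_add {R : ℝ} (θ : ℝ) (w : ℂ) :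
    ∃ c : ℂ, ‖c‖ = 1 ∧ ∀ y, ‖circleMap 0 R θ + w * y‖ = ‖(R : ℂ) + w * (c * y)‖ := by
  refine ⟨Complex.exp (-θ * Complex.I), ?_, fun y => ?_⟩
  · simpa using Complex.norm_exp_ofReal_mul_I (-θ)
  · have h1 : ‖Complex.exp (-θ * Complex.I)‖ = 1 := by
      simpa using Complex.norm_exp_ofReal_mul_I (-θ)
    rw [← one_mul ‖circleMap 0 R θ + w * y‖, ← h1, ← norm_mul]
    congr 1
    rw [circleMap_zero, mul_add]
    have : Complex.exp (-θ * Complex.I) * (R * Complex.exp (θ * Complex.I)) = R := by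
      rw [mul_left_comm, ← Complex.exp_add]; simp
    rw [this]; ring

/-- Subharmonicity of $\log|\cdot|$. The integral depends on `b` only through its modulus `R`, so it
equals its average over the circle of radius `R`. After Fubini, Jensen's formula evaluates the
circle average at fixed `x` as $\log R$ plus a nonnegative term. -/
lemma log_norm_le_integral_log_norm_affine {b : ℂ} (hb : b ≠ 0) {w : ℝ} (hw : 0 < w) :
    Real.log ‖b‖ ≤ ∫ x, Real.log ‖b + w * x‖ ∂stdComplexGaussian := by
  set R := ‖b‖ with hR
  have hR0 : 0 < R := norm_pos_iff.2 hb
  -- all phases of `b` give the same integral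
  have hphase : ∀ g : ℝ → ℝ, Measurable g → ∀ θ, ∫ x : ℂ, g ‖circleMap 0 R θ + w * x‖
      ∂stdComplexGaussian = ∫ x, g ‖(R : ℂ) + w * x‖ ∂stdComplexGaussian := by
    intro g hg θ
    obtain ⟨c, hc, h⟩ := exists_norm_eq_one_norm_circleMap_add (R := R) θ (w : ℂ)
    simp_rw [h]
    exact integral_comp_mul_of_norm_eq_one hc (f := fun x => g ‖(R : ℂ) + w * x‖)
      (hg.comp (by fun_prop))
  have hb' : circleMap 0 R (Complex.arg b) = b := by
    rw [circleMap_zero, hR]; exact Complex.norm_mul_exp_arg_mul_I b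
  have hmain : ∀ θ, ∫ x : ℂ, Real.log ‖circleMap 0 R θ + w * x‖ ∂stdComplexGaussian =
      ∫ x, Real.log ‖b + w * x‖ ∂stdComplexGaussian := by
    intro θ
    rw [hphase _ Real.measurable_log θ, ← hphase _ Real.measurable_log (Complex.arg b), hb']
  have hmeas : Measurable fun p : ℝ × ℂ => Real.log ‖circleMap 0 R p.1 + w * p.2‖ := by
    apply Real.measurable_log.comp
    apply Measurable.norm
    apply Continuous.measurable
    have := continuous_circleMap 0 R
    fun_prop
  have hint : Integrable (fun p : ℝ × ℂ => Real.log ‖circleMap 0 R p.1 + w * p.2‖)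
      ((volume.restrict (Set.Ioc 0 (2 * Real.pi))).prod stdComplexGaussian) := by
    rw [integrable_prod_iff hmeas.aestronglyMeasurable]
    refine ⟨ae_of_all _ fun θ => integrable_log_norm_affine (circleMap 0 R θ) hw, ?_⟩
    have : ∀ θ : ℝ, ∫ x : ℂ, ‖Real.log ‖circleMap 0 R θ + w * x‖‖ ∂stdComplexGaussian =
        ∫ x : ℂ, ‖Real.log ‖(R : ℂ) + w * x‖‖ ∂stdComplexGaussian := fun θ =>
      hphase (fun r => ‖Real.log r‖) Real.measurable_log.norm θ
    simp_rw [this]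
    exact integrable_const _
  have hswap := integral_integral_swap
    (f := fun θ (x : ℂ) => Real.log ‖circleMap 0 R θ + w * x‖) hint
  simp_rw [hmain] at hswap
  have hle : (2 * Real.pi) * Real.log R ≤ ∫ x : ℂ, (∫ θ in Set.Ioc 0 (2 * Real.pi),
      Real.log ‖circleMap 0 R θ + w * x‖) ∂stdComplexGaussian := by
    have hc : ∫ _ : ℂ, (2 * Real.pi) * Real.log R ∂stdComplexGaussian =
        (2 * Real.pi) * Real.log R := by simp
    rw [← hc]
    refine integral_mono_ae (integrable_const _) hint.integral_prod_right (ae_of_all _ fun x => ?_)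
    have h := circleAverage_log_norm_sub_const_eq_log_radius_add_posLog (a := -(w * x)) (c := 0)
      hR0.ne'
    rw [Real.circleAverage, intervalIntegral.integral_of_le (by positivity)] at h
    simp only [sub_neg_eq_add, smul_eq_mul] at h
    rw [inv_mul_eq_iff_eq_mul₀ (by positivity)] at h
    simp only [h]
    refine mul_le_mul_of_nonneg_left ?_ (by positivity)
    linarith [Real.posLog_nonneg (x := R⁻¹ * ‖0 + w * x‖)]
  rw [← hswap] at hle
  simp only [integral_const, measureReal_restrict_apply MeasurableSet.univ, Set.univ_inter,
    Real.volume_real_Ioc, sub_zero, smul_eq_mul] at hle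
  rw [max_eq_left (by positivity)] at hle
  exact le_of_mul_le_mul_left hle (by positivity)

/-! ### Affine functions of a Gaussian row -/

/-- The law of a row of `m` i.i.d. standard complex Gaussians. -/
noncomputable abbrev rowLaw (m : ℕ) : Measure (Fin m → ℂ) :=
  Measure.pi fun _ => stdComplexGaussian

/-- The Euclidean length of a coefficient vector. -/
noncomputable def coeffNorm {m : ℕ} (a : Fin m → ℂ) : ℝ := √(∑ j, ‖a j‖ ^ 2)

lemma norm_le_coeffNorm {m : ℕ} (a : Fin m → ℂ) (j : Fin m) : ‖a j‖ ≤ coeffNorm a := by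
  apply Real.le_sqrt_of_sq_le
  exact Finset.single_le_sum (f := fun j => ‖a j‖ ^ 2) (fun i _ => by positivity)
    (Finset.mem_univ j)

lemma map_sum_rowLaw {m : ℕ} (a : Fin m → ℂ) :
    (rowLaw m).map (fun x => ∑ j, a j * x j) =
      stdComplexGaussian.map ((coeffNorm a : ℂ) * ·) :=
  map_sum_mul_pi_stdComplexGaussian a _
    (Real.sq_sqrt (Finset.sum_nonneg fun i _ => by positivity))

lemma measurable_row {m : ℕ} (a : Fin m → ℂ) :
    Measurable fun x : Fin m → ℂ => ∑ j, a j * x j := by fun_prop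

lemma integral_row {m : ℕ} (a : Fin m → ℂ) {f : ℂ → ℝ} (hf : Measurable f) :
    ∫ x, f (∑ j, a j * x j) ∂(rowLaw m) = ∫ x, f (coeffNorm a * x) ∂stdComplexGaussian := by
  rw [← integral_map (f := f) (measurable_row a).aemeasurable hf.aestronglyMeasurable,
    map_sum_rowLaw, integral_map (by fun_prop) hf.aestronglyMeasurable]

lemma lintegral_row {m : ℕ} (a : Fin m → ℂ) {f : ℂ → ENNReal} (hf : Measurable f) :
    ∫⁻ x, f (∑ j, a j * x j) ∂(rowLaw m) = ∫⁻ x, f (coeffNorm a * x) ∂stdComplexGaussian := by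
  rw [← lintegral_map (f := f) hf (measurable_row a),
    map_sum_rowLaw, lintegral_map hf (by fun_prop)]

lemma ae_row_ne_zero {m : ℕ} {a : Fin m → ℂ} (b : ℂ) (ha : 0 < coeffNorm a) :
    ∀ᵐ x ∂(rowLaw m), b + ∑ j, a j * x j ≠ 0 := by
  have hs : MeasurableSet {y : ℂ | b + y ≠ 0} :=
    (measurableSet_eq_fun (by fun_prop) (by fun_prop)).compl
  rw [← ae_map_iff (p := fun y => b + y ≠ 0) (measurable_row a).aemeasurable hs,
    map_sum_rowLaw, ae_map_iff (by fun_prop) hs]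
  exact ae_add_mul_ne_zero b (by exact_mod_cast ha.ne')

lemma lintegral_posLog_inv_row_le {m : ℕ} {a : Fin m → ℂ} (b : ℂ) (ha : 0 < coeffNorm a) :
    ∫⁻ x, ENNReal.ofReal (Real.posLog ‖b + ∑ j, a j * x j‖⁻¹) ∂(rowLaw m) ≤
      ENNReal.ofReal negLogBound + ENNReal.ofReal (Real.posLog (coeffNorm a)⁻¹) := by
  rw [lintegral_row a (f := fun y => ENNReal.ofReal (Real.posLog ‖b + y‖⁻¹))
    (measurable_posLog_norm_inv (by fun_prop)).ennreal_ofReal]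
  exact lintegral_posLog_inv_affine_le b ha

lemma measurable_log_norm_add (b : ℂ) : Measurable fun y : ℂ => Real.log ‖b + y‖ :=
  Real.measurable_log.comp (by fun_prop)

lemma log_sub_le_integral_log_norm_row {m : ℕ} {a : Fin m → ℂ} (b : ℂ)
    (ha : 0 < coeffNorm a) :
    Real.log (coeffNorm a) - negLogBound ≤
      ∫ x, Real.log ‖b + ∑ j, a j * x j‖ ∂(rowLaw m) := by
  rw [integral_row a (measurable_log_norm_add b)]
  exact log_sub_le_integral_log_norm_affine b ha

lemma log_norm_le_integral_log_norm_row {m : ℕ} {a : Fin m → ℂ} {b : ℂ} (hb : b ≠ 0)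
    (ha : 0 < coeffNorm a) :
    Real.log ‖b‖ ≤ ∫ x, Real.log ‖b + ∑ j, a j * x j‖ ∂(rowLaw m) := by
  rw [integral_row a (measurable_log_norm_add b)]
  exact log_norm_le_integral_log_norm_affine hb ha

/-- Concavity of the logarithm: the length of a vector against the mean of its log-entries. -/
lemma mean_log_le_log_coeffNorm {n : ℕ} {a : Fin (n + 1) → ℂ} (ha : ∀ j, a j ≠ 0) :
    1 / 2 * Real.log (n + 1) + (n + 1 : ℝ)⁻¹ * ∑ j, Real.log ‖a j‖ ≤
      Real.log (coeffNorm a) := by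
  have hn : (0 : ℝ) < n + 1 := by positivity
  have hp : ∀ j, 0 < ‖a j‖ := fun j => norm_pos_iff.2 (ha j)
  -- Jensen with equal weights at the points $(n+1)|a_j|^2$, whose mean is exactly $\sum_j|a_j|^2$;
  -- the scaling produces the gain $\frac12\log(n+1)$.
  have h := strictConcaveOn_log_Ioi.concaveOn.le_map_sum (t := Finset.univ)
    (w := fun _ : Fin (n + 1) => (n + 1 : ℝ)⁻¹) (p := fun j => (n + 1 : ℝ) * ‖a j‖ ^ 2)
    (fun _ _ => by positivity) (by simp; field_simp)
    (fun j _ => by have := hp j; simp only [Set.mem_Ioi]; positivity)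
  simp only [smul_eq_mul, inv_mul_cancel_left₀ hn.ne'] at h
  rw [coeffNorm, Real.log_sqrt (Finset.sum_nonneg fun i _ => by positivity)]
  have h2 : ∀ j, Real.log ((n + 1 : ℝ) * ‖a j‖ ^ 2) =
      Real.log (n + 1) + 2 * Real.log ‖a j‖ := by
    intro j
    rw [Real.log_mul hn.ne' (by have := hp j; positivity), Real.log_pow]
    norm_num
  simp_rw [h2, ← Finset.mul_sum, Finset.sum_add_distrib, ← Finset.mul_sum] at h
  simp only [Finset.sum_const, Finset.card_univ, Fintype.card_fin, nsmul_eq_mul] at h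
  push_cast at h
  rw [mul_add, inv_mul_cancel_left₀ hn.ne'] at h
  linarith

/-! ### Determinants of Gaussian perturbations -/

/-- The law of an `n × n` complex Ginibre matrix, as a product of laws of rows. -/
noncomputable abbrev ginibreLaw (n : ℕ) : Measure (Fin n → Fin n → ℂ) :=
  Measure.pi fun _ => rowLaw n

/-- The matrix `A + s g`. -/
def perturbed {n : ℕ} (A : Matrix (Fin n) (Fin n) ℂ) (s : ℝ) (g : Fin n → Fin n → ℂ) :
    Matrix (Fin n) (Fin n) ℂ :=
  A + (s : ℂ) • Matrix.of g

lemma perturbed_apply {n : ℕ} (A : Matrix (Fin n) (Fin n) ℂ) (s : ℝ)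
    (g : Fin n → Fin n → ℂ) (i j : Fin n) : perturbed A s g i j = A i j + s * g i j := rfl

/-- With this indexing each factor depends on a single row, so the products factorise under the
product law of rows. -/
lemma det_eq_sum_prod_rows {n : ℕ} (M : Matrix (Fin n) (Fin n) ℂ) :
    M.det = ∑ σ : Equiv.Perm (Fin n), ((Equiv.Perm.sign σ : ℤ) : ℂ) * ∏ i, M i (σ i) := by
  rw [← Matrix.det_transpose, Matrix.det_apply']
  rfl

lemma measurable_det_perturbed {n : ℕ} (A : Matrix (Fin n) (Fin n) ℂ) (s : ℝ) :
    Measurable fun g : Fin n → Fin n → ℂ => (perturbed A s g).det := by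
  simp_rw [det_eq_sum_prod_rows, perturbed_apply]
  fun_prop

lemma integrable_eval_rowLaw {m : ℕ} (j : Fin m) :
    Integrable (fun x : Fin m → ℂ => x j) (rowLaw m) :=
  (measurePreserving_eval (fun _ : Fin m => stdComplexGaussian) j).integrable_comp_of_integrable
    integrable_id_stdComplexGaussian

lemma integrable_det_perturbed {n : ℕ} (A : Matrix (Fin n) (Fin n) ℂ) (s : ℝ) :
    Integrable (fun g => (perturbed A s g).det) (ginibreLaw n) := by
  simp_rw [det_eq_sum_prod_rows, perturbed_apply]
  refine integrable_finsetSum _ fun σ _ => Integrable.const_mul ?_ _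
  exact Integrable.fintype_prod (f := fun i (x : Fin n → ℂ) => A i (σ i) + s * x (σ i))
    fun i => (integrable_const _).add ((integrable_eval_rowLaw _).const_mul _)

/-- The law of `n` rows of `n + 1` i.i.d. standard complex Gaussians. -/
noncomputable abbrev restLaw (n : ℕ) : Measure (Fin n → Fin (n + 1) → ℂ) :=
  Measure.pi fun _ => rowLaw (n + 1)

/-- The minor of `A + s g` where row `i` and column `j` are deleted; `h` consists of the rows
of `g` other than the `i`-th. -/
noncomputable def minorDet {n : ℕ} (A : Matrix (Fin (n + 1)) (Fin (n + 1)) ℂ) (s : ℝ)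
    (i j : Fin (n + 1)) (h : Fin n → Fin (n + 1) → ℂ) : ℂ :=
  (perturbed (A.submatrix i.succAbove j.succAbove) s fun k l => h k (j.succAbove l)).det

/-- The matrix with `i`-th row `p.2` and remaining rows `p.1`. -/
def insertRow {n : ℕ} (i : Fin (n + 1))
    (p : (Fin n → Fin (n + 1) → ℂ) × (Fin (n + 1) → ℂ)) : Fin (n + 1) → Fin (n + 1) → ℂ :=
  i.insertNth (α := fun _ => Fin (n + 1) → ℂ) p.2 p.1

/-- Laplace expansion along row `i`: the minors do not involve that row, so the determinant is
affine in `x`. -/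
lemma det_perturbed_insertRow {n : ℕ} (A : Matrix (Fin (n + 1)) (Fin (n + 1)) ℂ) (s : ℝ)
    (i : Fin (n + 1)) (h : Fin n → Fin (n + 1) → ℂ) (x : Fin (n + 1) → ℂ) :
    (perturbed A s (insertRow i (h, x))).det =
      (∑ j : Fin (n + 1), (-1) ^ ((i : ℕ) + (j : ℕ)) * A i j * minorDet A s i j h) +
        ∑ j : Fin (n + 1), (s * (-1) ^ ((i : ℕ) + (j : ℕ)) * minorDet A s i j h) * x j := by
  rw [Matrix.det_succ_row _ i, ← Finset.sum_add_distrib]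
  refine Finset.sum_congr rfl fun j _ => ?_
  have : (perturbed A s (insertRow i (h, x))).submatrix
      i.succAbove j.succAbove =
      perturbed (A.submatrix i.succAbove j.succAbove) s fun k l => h k (j.succAbove l) := by
    ext k l
    simp [perturbed_apply, insertRow]
  rw [this, perturbed_apply, insertRow, Fin.insertNth_apply_same, minorDet]
  ring

lemma measurePreserving_insertRow {n : ℕ} (i : Fin (n + 1)) :
    MeasurePreserving (insertRow i) ((restLaw n).prod (rowLaw (n + 1))) (ginibreLaw (n + 1)) := by
  have h1 := (measurePreserving_piFinSuccAbove (fun _ : Fin (n + 1) => rowLaw (n + 1)) i).symm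
  have h2 := Measure.measurePreserving_swap (μ := restLaw n) (ν := rowLaw (n + 1))
  exact h1.comp h2

lemma measurePreserving_succAbove_comp {n : ℕ} (j : Fin (n + 1)) :
    MeasurePreserving (fun (x : Fin (n + 1) → ℂ) l => x (j.succAbove l))
      (rowLaw (n + 1)) (rowLaw n) := by
  have h1 := measurePreserving_piFinSuccAbove
    (fun _ : Fin (n + 1) => stdComplexGaussian) j
  have h2 := measurePreserving_snd (μ := stdComplexGaussian) (ν := rowLaw n)
  exact h2.comp h1

lemma measurePreserving_deleteColumn {n : ℕ} (j : Fin (n + 1)) :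
    MeasurePreserving (fun (h : Fin n → Fin (n + 1) → ℂ) k l => h k (j.succAbove l))
      (restLaw n) (ginibreLaw n) :=
  measurePreserving_pi _ _ fun _ => measurePreserving_succAbove_comp j

/-- The coefficients of the `i`-th row of `g` in the determinant of `A + s g`. -/
noncomputable def rowCoeff {n : ℕ} (A : Matrix (Fin (n + 1)) (Fin (n + 1)) ℂ) (s : ℝ)
    (i : Fin (n + 1)) (h : Fin n → Fin (n + 1) → ℂ) (j : Fin (n + 1)) : ℂ :=
  s * (-1) ^ ((i : ℕ) + (j : ℕ)) * minorDet A s i j h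

lemma norm_rowCoeff {n : ℕ} (A : Matrix (Fin (n + 1)) (Fin (n + 1)) ℂ) {s : ℝ} (hs : 0 < s)
    (i : Fin (n + 1)) (h : Fin n → Fin (n + 1) → ℂ) (j : Fin (n + 1)) :
    ‖rowCoeff A s i h j‖ = s * ‖minorDet A s i j h‖ := by
  simp [rowCoeff, abs_of_pos hs]

lemma coeffNorm_rowCoeff_pos {n : ℕ} {A : Matrix (Fin (n + 1)) (Fin (n + 1)) ℂ} {s : ℝ}
    (hs : 0 < s) {i j : Fin (n + 1)} {h : Fin n → Fin (n + 1) → ℂ}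
    (hj : minorDet A s i j h ≠ 0) : 0 < coeffNorm (rowCoeff A s i h) := by
  refine lt_of_lt_of_le ?_ (norm_le_coeffNorm _ j)
  rw [norm_rowCoeff A hs]
  have := norm_pos_iff.2 hj
  positivity

lemma ae_minorDet_ne_zero {n : ℕ} {s : ℝ}
    (hind : ∀ A : Matrix (Fin n) (Fin n) ℂ, ∀ᵐ g ∂(ginibreLaw n), (perturbed A s g).det ≠ 0)
    (A : Matrix (Fin (n + 1)) (Fin (n + 1)) ℂ) (i : Fin (n + 1)) :
    ∀ᵐ h ∂(restLaw n), ∀ j, minorDet A s i j h ≠ 0 := by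
  rw [ae_all_iff]
  intro j
  exact (measurePreserving_deleteColumn j).quasiMeasurePreserving.ae
    (hind (A.submatrix i.succAbove j.succAbove))

/-- A Gaussian perturbation of an arbitrary matrix is almost surely invertible. -/
theorem ae_det_perturbed_ne_zero {s : ℝ} (hs : 0 < s) :
    ∀ {n : ℕ} (A : Matrix (Fin n) (Fin n) ℂ),
      ∀ᵐ g ∂(ginibreLaw n), (perturbed A s g).det ≠ 0 := by
  intro n
  induction n with
  | zero => exact fun A => ae_of_all _ fun g => by simp
  | succ n ih =>
    intro A
    have hm : MeasurableSet {g | (perturbed A s g).det ≠ 0} :=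
      (measurableSet_eq_fun (measurable_det_perturbed A s) measurable_const).compl
    have hΦ := measurePreserving_insertRow (n := n) 0
    rw [← hΦ.map_eq, ae_map_iff hΦ.measurable.aemeasurable hm,
      Measure.ae_prod_iff_ae_ae (p := fun p => (perturbed A s (insertRow 0 p)).det ≠ 0)
        (hΦ.measurable hm)]
    filter_upwards [ae_minorDet_ne_zero ih A 0] with h hh
    simp_rw [det_perturbed_insertRow]
    exact ae_row_ne_zero _ (coeffNorm_rowCoeff_pos hs (hh 0))

/-- Supplies the integrability of $\log|\det|$ near zero that Fubini needs. In the expansion along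
row 0 the coefficient vector has length at least `s` times the modulus of the $(0,0)$ minor, so
conditionally $\log^-|\det|$ costs a constant plus $\log^-$ of that smaller determinant, and
induction applies. -/
theorem lintegral_posLog_inv_det_perturbed_lt_top {s : ℝ} (hs : 0 < s) :
    ∀ {n : ℕ} (A : Matrix (Fin n) (Fin n) ℂ),
      ∫⁻ g, ENNReal.ofReal (Real.posLog ‖(perturbed A s g).det‖⁻¹) ∂(ginibreLaw n) < ⊤ := by
  intro n
  induction n with
  | zero => intro A; simp
  | succ n ih =>
    intro A
    have hm : ∀ {m : ℕ} (B : Matrix (Fin m) (Fin m) ℂ), Measurable fun g =>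
        ENNReal.ofReal (Real.posLog ‖(perturbed B s g).det‖⁻¹) := fun B =>
      (measurable_posLog_norm_inv (measurable_det_perturbed B s)).ennreal_ofReal
    have hΦ := measurePreserving_insertRow (n := n) 0
    have hmp := measurePreserving_deleteColumn (n := n) 0
    rw [← hΦ.lintegral_comp (hm A), lintegral_prod (fun p => ENNReal.ofReal (Real.posLog ‖(perturbed A s (insertRow 0 p)).det‖⁻¹))
        ((hm A).comp hΦ.measurable).aemeasurable]
    have hbound : ∀ᵐ h ∂(restLaw n), ∫⁻ x, ENNReal.ofReal (Real.posLog
        ‖(perturbed A s (insertRow 0 (h, x))).det‖⁻¹) ∂(rowLaw (n + 1)) ≤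
        (ENNReal.ofReal negLogBound + ENNReal.ofReal (Real.posLog s⁻¹)) +
          ENNReal.ofReal (Real.posLog ‖minorDet A s 0 0 h‖⁻¹) := by
      filter_upwards [ae_minorDet_ne_zero (fun A => ae_det_perturbed_ne_zero hs A) A 0]
        with h hh
      simp_rw [det_perturbed_insertRow]
      refine (lintegral_posLog_inv_row_le _ (coeffNorm_rowCoeff_pos hs (hh 0))).trans ?_
      rw [add_assoc]
      gcongr
      rw [← ENNReal.ofReal_add Real.posLog_nonneg Real.posLog_nonneg]
      apply ENNReal.ofReal_le_ofReal
      have h1 : Real.posLog (coeffNorm (rowCoeff A s 0 h))⁻¹ ≤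
          Real.posLog (s⁻¹ * ‖minorDet A s 0 0 h‖⁻¹) := by
        refine Real.posLog_le_posLog (by have := coeffNorm_rowCoeff_pos hs (hh 0); positivity) ?_
        rw [← mul_inv, ← norm_rowCoeff A hs]
        refine inv_anti₀ ?_ (norm_le_coeffNorm _ _)
        rw [norm_rowCoeff A hs]
        have := norm_pos_iff.2 (hh 0)
        positivity
      exact h1.trans Real.posLog_mul
    refine (lintegral_mono_ae hbound).trans_lt ?_
    rw [lintegral_add_left measurable_const, lintegral_const, measure_univ, mul_one]
    have h2 := hmp.lintegral_comp (hm (A.submatrix (Fin.succAbove 0) (Fin.succAbove 0)))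
    have h3 := ih (A.submatrix (Fin.succAbove 0) (Fin.succAbove 0))
    rw [← h2] at h3
    exact ENNReal.add_lt_top.2 ⟨by simp, h3⟩

theorem integrable_log_norm_det_perturbed {s : ℝ} (hs : 0 < s) {n : ℕ}
    (A : Matrix (Fin n) (Fin n) ℂ) :
    Integrable (fun g => Real.log ‖(perturbed A s g).det‖) (ginibreLaw n) :=
  integrable_log_norm_of_posLog_inv (measurable_det_perturbed A s)
    (integrable_det_perturbed A s) (lintegral_posLog_inv_det_perturbed_lt_top hs A).ne

lemma integrable_log_norm_minorDet {s : ℝ} (hs : 0 < s) {n : ℕ}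
    (A : Matrix (Fin (n + 1)) (Fin (n + 1)) ℂ) (i j : Fin (n + 1)) :
    Integrable (fun h => Real.log ‖minorDet A s i j h‖) (restLaw n) :=
  (measurePreserving_deleteColumn j).integrable_comp_of_integrable
    (integrable_log_norm_det_perturbed hs (A.submatrix i.succAbove j.succAbove))

lemma integral_log_norm_minorDet {s : ℝ} {n : ℕ}
    (A : Matrix (Fin (n + 1)) (Fin (n + 1)) ℂ) (i j : Fin (n + 1)) :
    ∫ h, Real.log ‖minorDet A s i j h‖ ∂(restLaw n) =
      ∫ g, Real.log ‖(perturbed (A.submatrix i.succAbove j.succAbove) s g).det‖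
        ∂(ginibreLaw n) := by
  have hmp := measurePreserving_deleteColumn (n := n) j
  have hm : Measurable fun g : Fin n → Fin n → ℂ =>
      Real.log ‖(perturbed (A.submatrix i.succAbove j.succAbove) s g).det‖ :=
    Real.measurable_log.comp (measurable_det_perturbed _ s).norm
  rw [← hmp.map_eq, integral_map hmp.measurable.aemeasurable hm.aestronglyMeasurable]
  rfl

/-- To bound the mean of `log |det (A + s g)|` from below, it is enough to bound its conditional
mean given all rows but one. -/
lemma integral_le_integral_log_norm_det_perturbed {s : ℝ} (hs : 0 < s) {n : ℕ}
    (A : Matrix (Fin (n + 1)) (Fin (n + 1)) ℂ) (i : Fin (n + 1))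
    {F : (Fin n → Fin (n + 1) → ℂ) → ℝ} (hF : Integrable F (restLaw n))
    (hle : ∀ h, (∀ j, minorDet A s i j h ≠ 0) → F h ≤
      ∫ x, Real.log ‖(∑ j : Fin (n + 1), (-1) ^ ((i : ℕ) + (j : ℕ)) * A i j * minorDet A s i j h) +
        ∑ j, rowCoeff A s i h j * x j‖ ∂(rowLaw (n + 1))) :
    ∫ h, F h ∂(restLaw n) ≤ ∫ g, Real.log ‖(perturbed A s g).det‖ ∂(ginibreLaw (n + 1)) := by
  have hΦ := measurePreserving_insertRow (n := n) i
  have hint := hΦ.integrable_comp_of_integrable (integrable_log_norm_det_perturbed hs A)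
  have hm : Measurable fun g : Fin (n + 1) → Fin (n + 1) → ℂ =>
      Real.log ‖(perturbed A s g).det‖ :=
    Real.measurable_log.comp (measurable_det_perturbed A s).norm
  rw [← hΦ.map_eq, integral_map hΦ.measurable.aemeasurable hm.aestronglyMeasurable]
  rw [integral_prod (fun p => Real.log ‖(perturbed A s (insertRow i p)).det‖) hint]
  refine integral_mono_ae hF hint.integral_prod_left ?_
  filter_upwards [ae_minorDet_ne_zero (fun A => ae_det_perturbed_ne_zero hs A) A i] with h hh
  refine (hle h hh).trans (le_of_eq ?_)
  simp_rw [det_perturbed_insertRow]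
  rfl

/-- The mean log-determinant of `A + s g` is at least that of `s g`, up to `O(n)`. -/
theorem le_integral_log_norm_det_perturbed {s : ℝ} (hs : 0 < s) :
    ∀ {n : ℕ} (A : Matrix (Fin n) (Fin n) ℂ),
      n * Real.log s + 1 / 2 * Real.log n.factorial - n * negLogBound ≤
        ∫ g, Real.log ‖(perturbed A s g).det‖ ∂(ginibreLaw n) := by
  intro n
  induction n with
  | zero => intro A; simp
  | succ n ih =>
    intro A
    -- The increment of the claimed bound from `n` to `n + 1`. The remaining part of `F` is the
    -- average over the minors of row 0, each controlled by the induction hypothesis.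
    set c : ℝ := Real.log s + 1 / 2 * Real.log (n + 1) - negLogBound with hc
    have hI : ∀ j, Integrable (fun h => Real.log ‖minorDet A s 0 j h‖) (restLaw n) :=
      fun j => integrable_log_norm_minorDet hs A 0 j
    have hsum : Integrable
        (fun h => (n + 1 : ℝ)⁻¹ * ∑ j, Real.log ‖minorDet A s 0 j h‖) (restLaw n) :=
      (integrable_finsetSum _ fun j _ => hI j).const_mul _
    refine le_trans ?_ (integral_le_integral_log_norm_det_perturbed hs A 0
      (F := fun h => c + (n + 1 : ℝ)⁻¹ * ∑ j, Real.log ‖minorDet A s 0 j h‖)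
      ((integrable_const _).add hsum) ?_)
    · rw [integral_add (integrable_const _) hsum, integral_const_mul,
        integral_finsetSum _ fun j _ => hI j]
      simp_rw [integral_log_norm_minorDet]
      have h1 : ∑ _j : Fin (n + 1),
          (n * Real.log s + 1 / 2 * Real.log n.factorial - n * negLogBound) ≤
          ∑ j : Fin (n + 1), ∫ g, Real.log ‖(perturbed
            (A.submatrix (Fin.succAbove 0) j.succAbove) s g).det‖ ∂(ginibreLaw n) :=
        Finset.sum_le_sum fun j _ => ih _
      simp only [Finset.sum_const, Finset.card_univ, Fintype.card_fin, nsmul_eq_mul] at h1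
      have hn : (0 : ℝ) < n + 1 := by positivity
      rw [Nat.cast_add_one] at h1
      have h2 := mul_le_mul_of_nonneg_left h1 (inv_nonneg.2 hn.le)
      rw [inv_mul_cancel_left₀ hn.ne'] at h2
      rw [Nat.factorial_succ, Nat.cast_mul, Real.log_mul (by positivity) (by positivity)]
      simp only [integral_const, probReal_univ, one_smul, hc]
      push_cast
      linarith
    · intro h hh
      refine le_trans ?_ (log_sub_le_integral_log_norm_row _ (coeffNorm_rowCoeff_pos hs (hh 0)))
      have hne : ∀ j, rowCoeff A s 0 h j ≠ 0 := by
        intro j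
        rw [← norm_pos_iff, norm_rowCoeff A hs]
        have := norm_pos_iff.2 (hh j)
        positivity
      have h1 := mean_log_le_log_coeffNorm hne
      have h2 : ∀ j, Real.log ‖rowCoeff A s 0 h j‖ =
          Real.log s + Real.log ‖minorDet A s 0 j h‖ := by
        intro j
        rw [norm_rowCoeff A hs, Real.log_mul hs.ne' (norm_ne_zero_iff.2 (hh j))]
      simp_rw [h2, Finset.sum_add_distrib] at h1
      simp only [Finset.sum_const, Finset.card_univ, Fintype.card_fin, nsmul_eq_mul] at h1
      have hn : (n + 1 : ℝ) ≠ 0 := by positivity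
      rw [Nat.cast_add_one, mul_add, inv_mul_cancel_left₀ hn] at h1
      linarith

/-- If row `i` of `A` vanishes off the diagonal, then row and column `i` can be removed. -/
theorem log_norm_add_le_integral_log_norm_det_perturbed {s : ℝ} (hs : 0 < s) {n : ℕ}
    (A : Matrix (Fin (n + 1)) (Fin (n + 1)) ℂ) (i : Fin (n + 1))
    (hoff : ∀ j, j ≠ i → A i j = 0) (hdiag : A i i ≠ 0) :
    Real.log ‖A i i‖ + ∫ g, Real.log
        ‖(perturbed (A.submatrix i.succAbove i.succAbove) s g).det‖ ∂(ginibreLaw n) ≤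
      ∫ g, Real.log ‖(perturbed A s g).det‖ ∂(ginibreLaw (n + 1)) := by
  have hI := integrable_log_norm_minorDet hs A i i
  refine le_trans (le_of_eq ?_) (integral_le_integral_log_norm_det_perturbed hs A i
    (F := fun h => Real.log ‖A i i‖ + Real.log ‖minorDet A s i i h‖)
    ((integrable_const _).add hI) ?_)
  · rw [integral_add (integrable_const _) hI, integral_log_norm_minorDet]
    simp
  · intro h hh
    have hb : ∑ j : Fin (n + 1), (-1) ^ ((i : ℕ) + (j : ℕ)) * A i j * minorDet A s i j h =
        A i i * minorDet A s i i h := by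
      rw [Finset.sum_eq_single i (fun j _ hj => by simp [hoff j hj]) (by simp)]
      rw [Even.neg_one_pow ⟨_, rfl⟩, one_mul]
    rw [hb]
    have hne : A i i * minorDet A s i i h ≠ 0 := mul_ne_zero hdiag (hh i)
    rw [← Real.log_mul (norm_ne_zero_iff.2 hdiag) (norm_ne_zero_iff.2 (hh i)), ← norm_mul]
    exact log_norm_le_integral_log_norm_row hne (coeffNorm_rowCoeff_pos hs (hh i))

/-- The diagonal matrix with entries `σ 0, …, σ (m - 1)`. -/
def diagMatrix (σ : ℕ → ℝ) (m : ℕ) : Matrix (Fin m) (Fin m) ℂ :=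
  Matrix.diagonal fun i => (σ i : ℂ)

/-- The last row and column are removed one at a time, at the price $\log\sigma_i$ each, until the
leading `n × n` block is left; there the diagonal is ignored and only the noise counts. -/
theorem le_integral_log_norm_det_perturbed_diagMatrix {s : ℝ} (hs : 0 < s) (σ : ℕ → ℝ)
    {n m : ℕ} (hnm : n ≤ m) (hσ : ∀ i, n ≤ i → i < m → 0 < σ i) :
    ∑ i ∈ Finset.Ico n m, Real.log (σ i) +
        (n * Real.log s + 1 / 2 * Real.log n.factorial - n * negLogBound) ≤
      ∫ g, Real.log ‖(perturbed (diagMatrix σ m) s g).det‖ ∂(ginibreLaw m) := by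
  induction m, hnm using Nat.le_induction with
  | base => simpa using le_integral_log_norm_det_perturbed hs (diagMatrix σ n)
  | succ m hnm ih =>
    have h1 := ih fun i hi him => hσ i hi (by omega)
    have hpos : 0 < σ m := hσ m hnm (by omega)
    have h2 := log_norm_add_le_integral_log_norm_det_perturbed hs (diagMatrix σ (m + 1))
      (Fin.last m) (fun j hj => Matrix.diagonal_apply_ne' _ hj)
      (by simpa [diagMatrix] using hpos.ne')
    have h3 : (diagMatrix σ (m + 1)).submatrix (Fin.last m).succAbove (Fin.last m).succAbove =
        diagMatrix σ m := by
      ext k l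
      simp [diagMatrix, Matrix.diagonal_apply]
    rw [h3] at h2
    have h4 : ‖diagMatrix σ (m + 1) (Fin.last m) (Fin.last m)‖ = σ m := by
      simp [diagMatrix, abs_of_pos hpos]
    rw [h4] at h2
    rw [Finset.sum_Ico_succ_top hnm]
    linarith

/-! ### The second moment of the determinant -/

/-- A bound for the permanent of `diag (d) + c J`, where `J` is the all-ones matrix. -/
lemma sum_perm_prod_le {c : ℝ} (hc : 0 ≤ c) : ∀ (m : ℕ) (d : ℕ → ℝ), (∀ i, 0 ≤ d i) →
    ∑ π : Equiv.Perm (Fin m), ∏ i : Fin m, (c + if π i = i then d i else 0) ≤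
      ∏ i ∈ Finset.range m, (d i + c * ((m : ℝ) - i)) := by
  intro m
  induction m with
  | zero => intro d _; simp
  | succ m ih =>
    intro d hd
    -- A permutation of `Fin (m + 1)` is encoded by the image `p` of 0 and a permutation `e` of the
    -- other indices. If it fixes `i + 1`, then `e` fixes `i`, so replacing it by `e` loses no
    -- diagonal term. Summing over `p` yields the factor $d_0+c(m+1)$; removing index 0 at each
    -- stage is what produces the weights $m-i$.
    rw [← Equiv.sum_comp Equiv.Perm.decomposeFin.symm, Fintype.sum_prod_type]
    have hterm : ∀ (p : Fin (m + 1)) (e : Equiv.Perm (Fin m)),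
        ∏ i : Fin (m + 1), (c + if Equiv.Perm.decomposeFin.symm (p, e) i = i
          then d i else 0) ≤
        (c + if p = 0 then d 0 else 0) *
          ∏ i : Fin m, (c + if e i = i then d (i + 1) else 0) := by
      intro p e
      rw [Fin.prod_univ_succ, Equiv.Perm.decomposeFin_symm_apply_zero]
      refine mul_le_mul_of_nonneg_left (Finset.prod_le_prod (fun i _ => ?_) fun i _ => ?_) ?_
      · have := hd (i.succ : Fin (m + 1))
        split_ifs <;> linarith
      · rw [Equiv.Perm.decomposeFin_symm_apply_succ]
        have hdi := hd (i + 1)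
        by_cases h : e i = i
        · rw [if_pos h, Fin.val_succ]
          split_ifs <;> linarith
        · rw [if_neg h, if_neg]
          intro h'
          by_cases hp : (e i).succ = p
          · rw [hp, Equiv.swap_apply_right] at h'
            exact (Fin.succ_ne_zero i) h'.symm
          · rw [Equiv.swap_apply_of_ne_of_ne (Fin.succ_ne_zero _) hp] at h'
            exact h (Fin.succ_injective _ h')
      · have := hd 0
        split_ifs <;> simp <;> linarith
    refine (Finset.sum_le_sum fun p _ => Finset.sum_le_sum fun e _ => hterm p e).trans ?_
    simp_rw [← Finset.mul_sum, ← Finset.sum_mul]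
    have h0 : ∑ p : Fin (m + 1), (c + if p = 0 then d 0 else 0) = d 0 + c * (m + 1) := by
      rw [Finset.sum_add_distrib]
      simp
      ring
    rw [h0, Finset.prod_range_succ']
    have h1 := ih (fun i => d (i + 1)) fun i => hd _
    rw [mul_comm]
    have h2 : ∏ k ∈ Finset.range m, (d (k + 1) + c * (((m + 1 : ℕ) : ℝ) - ((k + 1 : ℕ) : ℝ))) =
        ∏ i ∈ Finset.range m, (d (i + 1) + c * ((m : ℝ) - i)) := by
      refine Finset.prod_congr rfl fun k _ => ?_
      push_cast
      ring
    rw [h2]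
    push_cast
    rw [sub_zero]
    exact mul_le_mul_of_nonneg_right h1 (by have := hd 0; positivity)

lemma memLp_eval_rowLaw {m : ℕ} (j : Fin m) : MemLp (fun x : Fin m → ℂ => x j) 2 (rowLaw m) :=
  memLp_two_stdComplexGaussian.comp_measurePreserving
    (measurePreserving_eval (fun _ : Fin m => stdComplexGaussian) j)

lemma integral_eval_rowLaw {m : ℕ} (j : Fin m) : ∫ x, x j ∂(rowLaw m) = 0 := by
  have h := measurePreserving_eval (fun _ : Fin m => stdComplexGaussian) j
  have h2 := integral_map (μ := rowLaw m) (φ := Function.eval j) (f := fun x : ℂ => x)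
    h.measurable.aemeasurable (by fun_prop)
  rw [h.map_eq, integral_id_stdComplexGaussian] at h2
  exact h2.symm

lemma integral_conj_eval_rowLaw {m : ℕ} (j : Fin m) :
    ∫ x, starRingEnd ℂ (x j) ∂(rowLaw m) = 0 := by
  rw [integral_conj, integral_eval_rowLaw, map_zero]

lemma integral_eval_mul_conj_eval_rowLaw {m : ℕ} (j k : Fin m) :
    ∫ x, x j * starRingEnd ℂ (x k) ∂(rowLaw m) = if j = k then 1 else 0 := by
  split_ifs with hjk
  · subst hjk
    have h := measurePreserving_eval (fun _ : Fin m => stdComplexGaussian) j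
    have h2 := integral_map (μ := rowLaw m) (φ := Function.eval j)
      (f := fun x : ℂ => x * starRingEnd ℂ x)
      h.measurable.aemeasurable (Continuous.aestronglyMeasurable (by fun_prop))
    rw [h.map_eq] at h2
    refine h2.symm.trans ?_
    have h3 : ∀ x : ℂ, x * starRingEnd ℂ x = ((‖x‖ ^ 2 : ℝ) : ℂ) := by
      intro x; rw [Complex.mul_conj, Complex.normSq_eq_norm_sq]
    simp_rw [h3]
    rw [integral_complex_ofReal, integral_norm_sq_stdComplexGaussian, Complex.ofReal_one]
  · -- flip the sign of the `j`-th coordinate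
    have hmp : MeasurePreserving (fun (x : Fin m → ℂ) i => (if i = j then (-1 : ℂ) else 1) * x i)
        (rowLaw m) (rowLaw m) := by
      refine measurePreserving_pi _ _ (f := fun i (y : ℂ) => (if i = j then (-1 : ℂ) else 1) * y)
        fun i => ⟨by fun_prop, ?_⟩
      exact map_mul_stdComplexGaussian_of_norm_eq_one (by split_ifs <;> simp)
    have h2 := integral_map (μ := rowLaw m) (f := fun x : Fin m → ℂ => x j * starRingEnd ℂ (x k))
      hmp.measurable.aemeasurable (Continuous.aestronglyMeasurable (by fun_prop))
    rw [hmp.map_eq] at h2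
    simp only [if_neg (Ne.symm hjk), if_true, one_mul, neg_mul] at h2
    exact self_eq_neg.1 (h2.trans (integral_neg _))

lemma memLp_affine_eval_rowLaw {m : ℕ} (a s : ℂ) (j : Fin m) :
    MemLp (fun x : Fin m → ℂ => a + s * x j) 2 (rowLaw m) :=
  (memLp_const a).add ((memLp_eval_rowLaw j).const_mul s)

lemma integrable_affine_mul_conj_affine {m : ℕ} (a b s : ℂ) (j k : Fin m) :
    Integrable (fun x : Fin m → ℂ => (a + s * x j) * starRingEnd ℂ (b + s * x k)) (rowLaw m) :=
  (memLp_affine_eval_rowLaw a s j).integrable_mul (memLp_affine_eval_rowLaw b s k).star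

lemma integral_affine_mul_conj_affine {m : ℕ} (a b : ℂ) (s : ℝ) (j k : Fin m) :
    ∫ x, (a + s * x j) * starRingEnd ℂ (b + s * x k) ∂(rowLaw m) =
      a * starRingEnd ℂ b + s ^ 2 * if j = k then 1 else 0 := by
  have h1 : ∀ x : Fin m → ℂ, (a + s * x j) * starRingEnd ℂ (b + s * x k) =
      (a * starRingEnd ℂ b + (a * s) * starRingEnd ℂ (x k)) +
        ((s * starRingEnd ℂ b) * x j + s ^ 2 * (x j * starRingEnd ℂ (x k))) := by
    intro x
    simp only [map_add, map_mul, Complex.conj_ofReal]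
    ring
  have hj := integrable_eval_rowLaw j
  have hk : Integrable (fun x : Fin m → ℂ => starRingEnd ℂ (x k)) (rowLaw m) :=
    (memLp_eval_rowLaw k).star.integrable (by norm_num)
  have hjk : Integrable (fun x : Fin m → ℂ => x j * starRingEnd ℂ (x k)) (rowLaw m) :=
    (memLp_eval_rowLaw j).integrable_mul (memLp_eval_rowLaw k).star
  simp_rw [h1]
  have hL : Integrable (fun x : Fin m → ℂ => a * starRingEnd ℂ b +
      (a * s) * starRingEnd ℂ (x k)) (rowLaw m) := (integrable_const _).add (hk.const_mul _)
  have hR : Integrable (fun x : Fin m → ℂ => (s * starRingEnd ℂ b) * x j +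
      s ^ 2 * (x j * starRingEnd ℂ (x k))) (rowLaw m) := (hj.const_mul _).add (hjk.const_mul _)
  rw [integral_add hL hR, integral_add (integrable_const _) (hk.const_mul _),
    integral_add (hj.const_mul _) (hjk.const_mul _), integral_const, integral_const_mul,
    integral_const_mul, integral_const_mul, integral_conj_eval_rowLaw, integral_eval_rowLaw,
    integral_eval_mul_conj_eval_rowLaw]
  simp

lemma norm_sq_det_eq_sum {n : ℕ} (M : Matrix (Fin n) (Fin n) ℂ) :
    ((‖M.det‖ ^ 2 : ℝ) : ℂ) = ∑ σ : Equiv.Perm (Fin n), ∑ τ : Equiv.Perm (Fin n),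
      (((Equiv.Perm.sign σ : ℤ) : ℂ) * ((Equiv.Perm.sign τ : ℤ) : ℂ)) *
        ∏ i, (M i (σ i) * starRingEnd ℂ (M i (τ i))) := by
  rw [← Complex.normSq_eq_norm_sq, ← Complex.mul_conj, det_eq_sum_prod_rows, map_sum,
    Finset.sum_mul_sum]
  refine Finset.sum_congr rfl fun σ _ => Finset.sum_congr rfl fun τ _ => ?_
  rw [map_mul, map_prod, Finset.prod_mul_distrib, map_intCast]
  ring

lemma integrable_prod_rows {n : ℕ} (A : Matrix (Fin n) (Fin n) ℂ) (s : ℝ)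
    (σ τ : Equiv.Perm (Fin n)) :
    Integrable (fun g => ∏ i, (perturbed A s g i (σ i) *
      starRingEnd ℂ (perturbed A s g i (τ i)))) (ginibreLaw n) := by
  simp_rw [perturbed_apply]
  exact Integrable.fintype_prod (f := fun i (x : Fin n → ℂ) => (A i (σ i) + s * x (σ i)) *
    starRingEnd ℂ (A i (τ i) + s * x (τ i))) fun i => integrable_affine_mul_conj_affine _ _ _ _ _

lemma integral_prod_rows {n : ℕ} (A : Matrix (Fin n) (Fin n) ℂ) (s : ℝ)
    (σ τ : Equiv.Perm (Fin n)) :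
    ∫ g, ∏ i, (perturbed A s g i (σ i) *
      starRingEnd ℂ (perturbed A s g i (τ i))) ∂(ginibreLaw n) =
      ∏ i, (A i (σ i) * starRingEnd ℂ (A i (τ i)) + s ^ 2 * if σ i = τ i then 1 else 0) := by
  simp_rw [perturbed_apply]
  rw [integral_fintype_prod_eq_prod (fun i (x : Fin n → ℂ) => (A i (σ i) + s * x (σ i)) *
    starRingEnd ℂ (A i (τ i) + s * x (τ i)))]
  simp_rw [integral_affine_mul_conj_affine]

lemma integrable_norm_sq_det_perturbed {n : ℕ} (A : Matrix (Fin n) (Fin n) ℂ) (s : ℝ) :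
    Integrable (fun g => ‖(perturbed A s g).det‖ ^ 2) (ginibreLaw n) := by
  have h : Integrable (fun g => ((‖(perturbed A s g).det‖ ^ 2 : ℝ) : ℂ)) (ginibreLaw n) := by
    simp_rw [norm_sq_det_eq_sum]
    exact integrable_finsetSum _ fun σ _ => integrable_finsetSum _ fun τ _ =>
      (integrable_prod_rows A s σ τ).const_mul _
  exact h.re

/-- In the double sum over permutations only the diagonal survives: where $\pi(i)\ne\tau(i)$ the
noise covariance vanishes, and so does $A_{i\pi(i)}\overline{A_{i\tau(i)}}$, because row `i` of a
diagonal matrix has at most one nonzero entry. -/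
theorem integral_norm_sq_det_perturbed_diagMatrix (σ : ℕ → ℝ) (s : ℝ) (m : ℕ) :
    ∫ g, ‖(perturbed (diagMatrix σ m) s g).det‖ ^ 2 ∂(ginibreLaw m) =
      ∑ π : Equiv.Perm (Fin m), ∏ i : Fin m, (s ^ 2 + if π i = i then σ i ^ 2 else 0) := by
  rw [← Complex.ofReal_inj, ← integral_complex_ofReal]
  simp_rw [norm_sq_det_eq_sum]
  rw [integral_finsetSum _ fun π _ => integrable_finsetSum _ fun τ _ =>
      (integrable_prod_rows _ s π τ).const_mul _, Complex.ofReal_sum]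
  refine Finset.sum_congr rfl fun π _ => ?_
  rw [integral_finsetSum _ fun τ _ => (integrable_prod_rows _ s π τ).const_mul _]
  simp_rw [integral_const_mul, integral_prod_rows]
  rw [Finset.sum_eq_single π]
  · have h1 : ((Equiv.Perm.sign π : ℤ) : ℂ) * ((Equiv.Perm.sign π : ℤ) : ℂ) = 1 := by
      rw [← Int.cast_mul, ← Units.val_mul, Int.units_mul_self]
      simp
    rw [h1, one_mul, Complex.ofReal_prod]
    refine Finset.prod_congr rfl fun i _ => ?_
    by_cases h : π i = i
    · simp [diagMatrix, h]; ring
    · simp [diagMatrix, h, Matrix.diagonal_apply_ne' _ h]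
  · intro τ _ hτ
    obtain ⟨i, hi⟩ : ∃ i, π i ≠ τ i := by
      by_contra! h
      exact hτ (Equiv.ext fun i => (h i).symm)
    rw [Finset.prod_eq_zero (Finset.mem_univ i), mul_zero]
    rw [if_neg hi, mul_zero, add_zero]
    by_cases h : π i = i
    · have h2 : τ i ≠ i := fun h' => hi (h.trans h'.symm)
      simp [diagMatrix, Matrix.diagonal_apply_ne' _ h2]
    · simp [diagMatrix, Matrix.diagonal_apply_ne' _ h]
  · simp

theorem integral_norm_sq_det_perturbed_diagMatrix_le (σ : ℕ → ℝ) (s : ℝ) (m : ℕ) :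
    ∫ g, ‖(perturbed (diagMatrix σ m) s g).det‖ ^ 2 ∂(ginibreLaw m) ≤
      ∏ i ∈ Finset.range m, (σ i ^ 2 + s ^ 2 * ((m : ℝ) - i)) := by
  rw [integral_norm_sq_det_perturbed_diagMatrix]
  exact sum_perm_prod_le (sq_nonneg s) m (fun i => σ i ^ 2) fun i => sq_nonneg _

/-! ### Concentration of the log-determinant in mean -/

/-- A lower bound for the mean and a bound for an exponential moment give concentration in `L¹`. -/
lemma integral_abs_sub_le_of_exp_le {α : Type*} [MeasurableSpace α] {ρ : Measure α}
    [IsProbabilityMeasure ρ] {Y : α → ℝ} {u v : ℝ} (hY : Integrable Y ρ) (hu : u ≤ ∫ x, Y x ∂ρ)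
    (hexp : Integrable (fun x => Real.exp (2 * (Y x - v))) ρ)
    (hle : ∫ x, Real.exp (2 * (Y x - v)) ∂ρ ≤ 1) :
    ∫ x, |Y x - v| ∂ρ ≤ 1 + v - u := by
  have hYv : Integrable (fun x => Y x - v) ρ := hY.sub (integrable_const v)
  -- Pointwise $|t|\le e^{2t}-t$, from $1+2t\le e^{2t}$ and $e^{2t}>0$.
  have h1 : ∫ x, |Y x - v| ∂ρ ≤ ∫ x, (Real.exp (2 * (Y x - v)) - (Y x - v)) ∂ρ := by
    refine integral_mono hYv.abs (hexp.sub hYv) fun x => ?_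
    have h2 := Real.add_one_le_exp (2 * (Y x - v))
    have h3 := Real.exp_pos (2 * (Y x - v))
    refine abs_le'.2 ⟨?_, ?_⟩ <;> linarith
  rw [integral_sub hexp hYv, integral_sub hY (integrable_const v)] at h1
  simp only [integral_const, probReal_univ, one_smul] at h1
  linarith

/-- The lower half of Stirling: $n^n/n!$ is one term of the series of $e^n$. -/
lemma mul_log_sub_le_log_factorial (n : ℕ) :
    n * Real.log n - n ≤ Real.log n.factorial := by
  rcases Nat.eq_zero_or_pos n with rfl | hn
  · simp
  have h := Real.pow_div_factorial_le_exp (x := n) (Nat.cast_nonneg n) n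
  have h2 := Real.log_le_log (by positivity) h
  rw [Real.log_div (by positivity) (by positivity), Real.log_pow, Real.log_exp] at h2
  linarith

theorem integral_abs_log_norm_det_sub_le {s : ℝ} (hs : 0 < s) (σ : ℕ → ℝ) {n m : ℕ}
    (hnm : n ≤ m) (hσ : ∀ i, n ≤ i → i < m → 0 < σ i) {V : ℝ}
    (hV : ∏ i ∈ Finset.range m, (σ i ^ 2 + s ^ 2 * ((m : ℝ) - i)) ≤
      Real.exp (2 * ∑ i ∈ Finset.Ico n m, Real.log (σ i) + V)) :
    ∫ g, |Real.log ‖(perturbed (diagMatrix σ m) s g).det‖ -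
        ∑ i ∈ Finset.Ico n m, Real.log (σ i) - V / 2| ∂(ginibreLaw m) ≤
      1 + V / 2 - (n * Real.log s + 1 / 2 * (n * Real.log n - n) - n * negLogBound) := by
  set L := ∑ i ∈ Finset.Ico n m, Real.log (σ i) with hL
  have hI := integrable_log_norm_det_perturbed hs (diagMatrix σ m)
  have hY : Integrable (fun g => Real.log ‖(perturbed (diagMatrix σ m) s g).det‖ - L)
      (ginibreLaw m) := hI.sub (integrable_const L)
  -- Only almost everywhere: at a singular matrix `Real.log 0 = 0` breaks the identity.
  have hae : ∀ᵐ g ∂(ginibreLaw m), Real.exp (2 * (Real.log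
      ‖(perturbed (diagMatrix σ m) s g).det‖ - L - V / 2)) =
      Real.exp (-(2 * L + V)) * ‖(perturbed (diagMatrix σ m) s g).det‖ ^ 2 := by
    filter_upwards [ae_det_perturbed_ne_zero hs (diagMatrix σ m)] with g hg
    have h0 := norm_pos_iff.2 hg
    rw [← Real.exp_log (pow_pos h0 2), ← Real.exp_add, Real.log_pow]
    congr 1
    push_cast
    ring
  refine integral_abs_sub_le_of_exp_le hY ?_ ?_ ?_
  · rw [integral_sub hI (integrable_const L)]
    have h1 := le_integral_log_norm_det_perturbed_diagMatrix hs σ hnm hσ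
    have h2 := mul_log_sub_le_log_factorial n
    simp only [integral_const, probReal_univ, one_smul]
    linarith
  · rw [integrable_congr hae]
    exact (integrable_norm_sq_det_perturbed _ s).const_mul _
  · rw [integral_congr_ae hae, integral_const_mul]
    have h1 := (integral_norm_sq_det_perturbed_diagMatrix_le σ s m).trans hV
    calc _ ≤ Real.exp (-(2 * L + V)) * Real.exp (2 * L + V) :=
          mul_le_mul_of_nonneg_left h1 (Real.exp_pos _).le
      _ = 1 := by rw [← Real.exp_add]; simp

/-! ### Singular values and the truncation index -/

section Truncation

variable {N : ℕ} (A : Matrix (Fin N) (Fin N) ℂ)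

lemma sigmaUp_nonneg (k : ℕ) : 0 ≤ sigmaUp A k := LinearMap.singularValues_nonneg _ _

lemma sigmaUp_mono {k l : ℕ} (h : k ≤ l) : sigmaUp A k ≤ sigmaUp A l :=
  LinearMap.singularValues_antitone _ (by omega)

lemma truncIndex_cases (γ ε : ℝ) (d : ℕ) :
    (truncIndex A γ ε d ∈ smallIndices A γ ε ∨
      (truncIndex A γ ε d = d ∧ smallIndices A γ ε = ∅)) ∧
      ∀ i ∈ smallIndices A γ ε, i ≤ truncIndex A γ ε d := by
  unfold truncIndex
  split_ifs with h
  · exact ⟨Or.inl (Finset.max'_mem _ h), fun i hi => Finset.le_max' _ i hi⟩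
  · rw [Finset.not_nonempty_iff_eq_empty] at h
    exact ⟨Or.inr ⟨rfl, h⟩, by simp [h]⟩

/-- `1 ≤ N` is needed because the default value may be 1. -/
lemma truncIndex_le (γ ε : ℝ) {d : ℕ} (hd : d ≤ 1) (hN : 1 ≤ N) :
    truncIndex A γ ε d ≤ N := by
  rcases (truncIndex_cases A γ ε d).1 with h | h
  · exact (Finset.mem_Icc.1 (Finset.mem_filter.1 h).1).2
  · omega

/-- Maximality of $N^*$, with `i` counted from 0: the singular value of index $i+1$ has threshold
weight $N-(i+1)+1=N-i$, exactly the weight in the second-moment bound. -/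
lemma threshold_le_sigmaUp (γ ε : ℝ) (d : ℕ) {i : ℕ} (hi : truncIndex A γ ε d ≤ i)
    (hiN : i < N) :
    ε⁻¹ * (N : ℝ) ^ (-γ) * √((N : ℝ) - i) ≤ sigmaUp A (i + 1) := by
  by_contra! h
  have hmem : i + 1 ∈ smallIndices A γ ε := by
    refine Finset.mem_filter.2 ⟨Finset.mem_Icc.2 ⟨by omega, by omega⟩, ?_⟩
    refine h.trans_le (le_of_eq ?_)
    push_cast
    congr 2
    ring
  have := (truncIndex_cases A γ ε d).2 _ hmem
  omega

lemma sigmaUp_pos_of_truncIndex_le (γ : ℝ) {ε : ℝ} (hε : 0 < ε) (d : ℕ) {i : ℕ}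
    (hi : truncIndex A γ ε d ≤ i) (hiN : i < N) : 0 < sigmaUp A (i + 1) := by
  refine lt_of_lt_of_le ?_ (threshold_le_sigmaUp A γ ε d hi hiN)
  have h1 : (0 : ℝ) < N := by exact_mod_cast (by omega : 0 < N)
  have h2 : (0 : ℝ) < (N : ℝ) - i := by
    have : (i : ℝ) < N := by exact_mod_cast hiN
    linarith
  have := Real.rpow_pos_of_pos h1 (-γ)
  have := Real.sqrt_pos.2 h2
  positivity

lemma det_largeBlock (n : ℕ) :
    (largeBlock A n).det = ((∏ i ∈ Finset.Ico n N, sigmaUp A (i + 1) : ℝ) : ℂ) := by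
  rw [largeBlock, sigmaMatrix, Matrix.submatrix_diagonal _ _ Subtype.val_injective,
    Matrix.det_diagonal, Complex.ofReal_prod]
  refine Finset.prod_bij (fun i _ => (i.1 : ℕ)) (fun i _ => Finset.mem_Ico.2 ⟨i.2, i.1.2⟩)
    (fun i _ j _ h => Subtype.ext (Fin.ext h)) (fun i hi => ?_) (fun i _ => rfl)
  rw [Finset.mem_Ico] at hi
  exact ⟨⟨⟨i, hi.2⟩, hi.1⟩, Finset.mem_univ _, rfl⟩

lemma sq_rpow_neg_mul_self (γ : ℝ) (hN : 1 ≤ N) :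
    ((N : ℝ) ^ (-γ)) ^ 2 * N = Real.exp ((1 - 2 * γ) * Real.log N) := by
  have h1 : (0 : ℝ) < N := by exact_mod_cast hN
  rw [Real.rpow_def_of_pos h1, ← Real.exp_nat_mul]
  nth_rewrite 2 [← Real.exp_log h1]
  rw [← Real.exp_add]
  congr 1
  push_cast
  ring

/-- The exponent in the bound for the second moment of the determinant. -/
noncomputable def momentExponent (γ ε : ℝ) (d n : ℕ) : ℝ :=
  n * ((1 - 2 * γ) * Real.log N + Real.log (1 + (ε⁻¹) ^ 2)) +
    d * (2 * Real.posLog (sigmaUp A 1) + Real.log 2 - (1 - 2 * γ) * Real.log N) + N * ε ^ 2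

/-- The product splits at $N^*$. The summand with factor `d` in `momentExponent` pays for the
convention $N^*=1$, under which the first singular value is removed without being small. -/
theorem prod_le_exp_momentExponent {γ : ℝ} (hγ : 1 / 2 < γ) {ε : ℝ} (hε : 0 < ε) {d : ℕ}
    (hd : d ≤ 1) (hN : 1 ≤ N) :
    ∏ i ∈ Finset.range N, (sigmaUp A (i + 1) ^ 2 +
        ((N : ℝ) ^ (-γ)) ^ 2 * ((N : ℝ) - i)) ≤
      Real.exp (2 * ∑ i ∈ Finset.Ico (truncIndex A γ ε d) N, Real.log (sigmaUp A (i + 1)) +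
        momentExponent A γ ε d (truncIndex A γ ε d)) := by
  set n := truncIndex A γ ε d with hn
  have hnN : n ≤ N := truncIndex_le A γ ε hd hN
  have hN0 : (0 : ℝ) < N := by exact_mod_cast hN
  set s := (N : ℝ) ^ (-γ) with hs
  have hs0 : 0 < s := Real.rpow_pos_of_pos hN0 _
  have hsN : s ^ 2 * N = Real.exp ((1 - 2 * γ) * Real.log N) := sq_rpow_neg_mul_self γ hN
  have hlogN : 0 ≤ Real.log N := Real.log_natCast_nonneg N
  have hneg : (1 - 2 * γ) * Real.log N ≤ 0 := mul_nonpos_of_nonpos_of_nonneg (by linarith) hlogN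
  have hNi : ∀ i ∈ Finset.range N, (0 : ℝ) ≤ (N : ℝ) - i := by
    intro i hi
    have : (i : ℝ) ≤ N := by exact_mod_cast (Finset.mem_range.1 hi).le
    linarith
  -- Above the threshold $s^2(N-i)\le\varepsilon^2\sigma^2$, and $1+\varepsilon^2\le
  -- e^{\varepsilon^2}$.
  have hlarge : ∏ i ∈ Finset.Ico n N, (sigmaUp A (i + 1) ^ 2 + s ^ 2 * ((N : ℝ) - i)) ≤
      Real.exp (2 * ∑ i ∈ Finset.Ico n N, Real.log (sigmaUp A (i + 1)) + N * ε ^ 2) := by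
    have h1 : ∀ i ∈ Finset.Ico n N, sigmaUp A (i + 1) ^ 2 + s ^ 2 * ((N : ℝ) - i) ≤
        Real.exp (2 * Real.log (sigmaUp A (i + 1)) + ε ^ 2) := by
      intro i hi
      rw [Finset.mem_Ico] at hi
      have hpos := sigmaUp_pos_of_truncIndex_le A γ hε d hi.1 hi.2
      have hth := threshold_le_sigmaUp A γ ε d hi.1 hi.2
      have hge := hNi i (Finset.mem_range.2 hi.2)
      have h2 : s * √((N : ℝ) - i) ≤ ε * sigmaUp A (i + 1) := by
        have := mul_le_mul_of_nonneg_left hth hε.le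
        rwa [← mul_assoc, mul_inv_cancel_left₀ hε.ne'] at this
      have h3 := pow_le_pow_left₀ (by positivity) h2 2
      rw [mul_pow, Real.sq_sqrt hge, mul_pow] at h3
      have h4 : Real.exp (2 * Real.log (sigmaUp A (i + 1))) = sigmaUp A (i + 1) ^ 2 := by
        rw [← Real.exp_log (pow_pos hpos 2), Real.log_pow]
        norm_num
      rw [Real.exp_add, h4]
      have h5 := Real.add_one_le_exp (ε ^ 2)
      nlinarith [sq_nonneg (sigmaUp A (i + 1))]
    refine (Finset.prod_le_prod (fun i hi => ?_) h1).trans ?_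
    · have := hNi i (Finset.mem_range.2 (Finset.mem_Ico.1 hi).2)
      positivity
    · rw [← Real.exp_sum, Real.exp_le_exp, Finset.sum_add_distrib, ← Finset.mul_sum]
      simp only [Finset.sum_const, Nat.card_Ico, nsmul_eq_mul]
      have : ((N - n : ℕ) : ℝ) ≤ N := by exact_mod_cast Nat.sub_le N n
      nlinarith [sq_nonneg ε]
  have hsmall : ∏ i ∈ Finset.range n, (sigmaUp A (i + 1) ^ 2 + s ^ 2 * ((N : ℝ) - i)) ≤
      Real.exp (n * ((1 - 2 * γ) * Real.log N + Real.log (1 + (ε⁻¹) ^ 2)) +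
        d * (2 * Real.posLog (sigmaUp A 1) + Real.log 2 - (1 - 2 * γ) * Real.log N)) := by
    -- Nonnegative, so the correction may be kept even when $N^*$ is a genuine small index.
    have hextra : 0 ≤ 2 * Real.posLog (sigmaUp A 1) + Real.log 2 -
        (1 - 2 * γ) * Real.log N := by
      have := Real.posLog_nonneg (x := sigmaUp A 1)
      have := Real.log_nonneg (one_le_two (α := ℝ))
      linarith
    have hrate : 0 ≤ Real.log (1 + (ε⁻¹) ^ 2) :=
      Real.log_nonneg (by have := sq_nonneg ε⁻¹; linarith)
    rcases (truncIndex_cases A γ ε d).1 with hmem | ⟨hnd, -⟩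
    · rw [← hn] at hmem
      obtain ⟨hIcc, hlt⟩ := Finset.mem_filter.1 hmem
      -- By monotonicity every earlier singular value lies below the threshold at $N^*$, hence below
      -- $\varepsilon^{-1}s\sqrt N$.
      have h1 : ∀ i ∈ Finset.range n, sigmaUp A (i + 1) ^ 2 + s ^ 2 * ((N : ℝ) - i) ≤
          Real.exp ((1 - 2 * γ) * Real.log N + Real.log (1 + (ε⁻¹) ^ 2)) := by
        intro i hi
        have hi' := Finset.mem_range.1 hi
        rw [Real.exp_add, ← hsN, Real.exp_log (by positivity)]
        have hn1 : (1 : ℝ) ≤ n := by exact_mod_cast (Finset.mem_Icc.1 hIcc).1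
        have h2 : sigmaUp A (i + 1) ≤ ε⁻¹ * s * √N := by
          refine (sigmaUp_mono A (Nat.succ_le_of_lt hi')).trans (hlt.le.trans ?_)
          gcongr
          linarith
        have h3 := pow_le_pow_left₀ (sigmaUp_nonneg A _) h2 2
        rw [mul_pow, mul_pow, Real.sq_sqrt hN0.le] at h3
        have h4 : s ^ 2 * ((N : ℝ) - i) ≤ s ^ 2 * N := by
          gcongr
          have := Nat.cast_nonneg (α := ℝ) i
          linarith
        linarith
      refine (Finset.prod_le_prod (fun i hi => ?_) h1).trans ?_
      · have := hNi i (Finset.mem_range.2 ((Finset.mem_range.1 hi).trans_le hnN))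
        positivity
      · rw [Finset.prod_const, Finset.card_range, ← Real.exp_nat_mul, Real.exp_le_exp]
        have : 0 ≤ (d : ℝ) * (2 * Real.posLog (sigmaUp A 1) + Real.log 2 -
          (1 - 2 * γ) * Real.log N) := by positivity
        linarith
    -- No small index. For `d = 0` the product is empty; for `d = 1` its only factor is at most
    -- $2e^{2\log^+\sigma_1}$, and the correction cancels the term $(1-2\gamma)\log N$ coming from
    -- `n = 1`.
    · rw [← hn] at hnd
      rcases Nat.le_one_iff_eq_zero_or_eq_one.1 hd with h0 | h1
      · rw [hnd, h0]
        simp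
      · rw [hnd, h1]
        simp only [Finset.range_one, Finset.prod_singleton, zero_add, Nat.cast_zero, sub_zero,
          Nat.cast_one, one_mul]
        have h2 : s ^ 2 * N ≤ 1 := by rw [hsN]; exact Real.exp_le_one_iff.2 hneg
        have h3 : sigmaUp A 1 ^ 2 ≤ Real.exp (2 * Real.posLog (sigmaUp A 1)) := by
          have h4 : sigmaUp A 1 ≤ Real.exp (Real.posLog (sigmaUp A 1)) := by
            rcases (sigmaUp_nonneg A 1).eq_or_lt with h | h
            · rw [← h]; positivity
            · calc sigmaUp A 1 = Real.exp (Real.log (sigmaUp A 1)) := (Real.exp_log h).symm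
                _ ≤ _ := Real.exp_le_exp.2 (le_max_right _ _)
          have := pow_le_pow_left₀ (sigmaUp_nonneg A 1) h4 2
          rwa [← Real.exp_nat_mul, Nat.cast_ofNat] at this
        have h5 : 1 ≤ Real.exp (2 * Real.posLog (sigmaUp A 1)) :=
          Real.one_le_exp (by have := Real.posLog_nonneg (x := sigmaUp A 1); positivity)
        calc sigmaUp A 1 ^ 2 + s ^ 2 * N ≤
            Real.exp (2 * Real.posLog (sigmaUp A 1)) * 2 := by linarith
          _ = Real.exp (2 * Real.posLog (sigmaUp A 1) + Real.log 2) := by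
            rw [Real.exp_add, Real.exp_log two_pos]
          _ ≤ _ := Real.exp_le_exp.2 (by linarith)
  rw [← Finset.prod_range_mul_prod_Ico _ hnN]
  refine (mul_le_mul hsmall hlarge (Finset.prod_nonneg fun i hi => ?_)
    (Real.exp_pos _).le).trans (le_of_eq ?_)
  · have := hNi i (Finset.mem_range.2 (Finset.mem_Ico.1 hi).2)
    positivity
  · rw [← Real.exp_add, momentExponent]
    congr 1
    ring

end Truncation

/-! ### The law of a Ginibre matrix -/

theorem IsGinibre.hasLaw_ginibreLaw {Ω : Type*} [MeasurableSpace Ω] {P : Measure Ω}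
    [IsProbabilityMeasure P] {N : ℕ} {G : Ω → Matrix (Fin N) (Fin N) ℂ} (hG : IsGinibre P G) :
    HasLaw (fun ω i j => G ω i j) (ginibreLaw N) P := by
  have hm : AEMeasurable (fun ω (p : Fin N × Fin N) => G ω p.1 p.2) P :=
    aemeasurable_pi_iff.2 fun p => (hG.hasLaw p.1 p.2).aemeasurable
  have h1 := (iIndepFun_iff_map_fun_eq_pi_map
    fun p : Fin N × Fin N => (hG.hasLaw p.1 p.2).aemeasurable).1 hG.indep
  simp_rw [(hG.hasLaw _ _).map_eq] at h1
  -- Currying turns the product law over pairs of indices into a product of row laws.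
  have h2 := Measure.infinitePi_map_curry (fun _ _ : Fin N => stdComplexGaussian)
  simp_rw [Measure.infinitePi_eq_pi] at h2
  refine ⟨aemeasurable_pi_iff.2 fun i => aemeasurable_pi_iff.2 fun j =>
    (hG.hasLaw i j).aemeasurable, ?_⟩
  rw [ginibreLaw, rowLaw, ← h2, ← h1, AEMeasurable.map_map_of_aemeasurable
    (MeasurableEquiv.measurable _).aemeasurable hm]
  rfl

/-! ### Asymptotics of the error terms -/

lemma tendsto_log_natCast_atTop : Tendsto (fun N : ℕ => Real.log N) atTop atTop :=
  Real.tendsto_log_atTop.comp tendsto_natCast_atTop_atTop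

lemma tendsto_log_natCast_div : Tendsto (fun N : ℕ => Real.log N / N) atTop (𝓝 0) := by
  have h := (Real.isLittleO_log_id_atTop.tendsto_div_nhds_zero).comp
    (tendsto_natCast_atTop_atTop (R := ℝ))
  exact h

section Asymptotics

variable {n : ℕ → ℕ} {α : ℝ}

lemma tendsto_div_of_tendsto_mul_log_div
    (hα : Tendsto (fun N : ℕ => (n N : ℝ) * Real.log N / N) atTop (𝓝 α)) :
    Tendsto (fun N : ℕ => (n N : ℝ) / N) atTop (𝓝 0) := by
  have h := hα.mul (tendsto_inv_atTop_zero.comp tendsto_log_natCast_atTop)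
  rw [mul_zero] at h
  refine h.congr' ?_
  filter_upwards [tendsto_log_natCast_atTop.eventually_gt_atTop 0] with N hN
  simp only [Function.comp]
  field_simp

/-- $\frac nN\log n=\frac nN\log N+\frac nN\log\frac nN$, and $x\log x\to0$ as $x=n/N\to0$. -/
lemma tendsto_mul_log_self_div
    (hα : Tendsto (fun N : ℕ => (n N : ℝ) * Real.log N / N) atTop (𝓝 α)) :
    Tendsto (fun N : ℕ => (n N : ℝ) * Real.log (n N) / N) atTop (𝓝 α) := by
  have h1 := (Real.continuous_mul_log.tendsto 0).comp (tendsto_div_of_tendsto_mul_log_div hα)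
  rw [zero_mul] at h1
  have h2 := hα.add h1
  rw [add_zero] at h2
  refine h2.congr' ?_
  filter_upwards [eventually_ge_atTop 1] with N hN
  have hN0 : (N : ℝ) ≠ 0 := by positivity
  rcases Nat.eq_zero_or_pos (n N) with h | h
  · simp [h]
  · have hn : (n N : ℝ) ≠ 0 := by positivity
    simp only [Function.comp]
    rw [Real.log_div hn hN0]
    ring

/-- Once $\varepsilon<1$, $\log(1+\varepsilon^{-2})\le\log2+2\log\varepsilon^{-1}$. The main part is
$\frac{n\log N}N\cdot\frac{\log\varepsilon^{-1}}{\log N}$: either the second factor vanishes in the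
limit, or it tends to $\eta$ while the first tends to $\alpha=0$. -/
lemma tendsto_mul_log_one_add_div {ε : ℕ → ℝ} (hε_pos : ∀ N, 1 ≤ N → 0 < ε N)
    (hε : Tendsto ε atTop (𝓝 0))
    (hα : Tendsto (fun N : ℕ => (n N : ℝ) * Real.log N / N) atTop (𝓝 α))
    (hrate : Tendsto (fun N : ℕ => Real.log (ε N)⁻¹ / Real.log N) atTop (𝓝 0) ∨
      (α = 0 ∧ ∃ η : ℝ, 0 < η ∧ ∀ N : ℕ, 1 ≤ N → ε N = (N : ℝ) ^ (-η))) :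
    Tendsto (fun N : ℕ => (n N : ℝ) * Real.log (1 + ((ε N)⁻¹) ^ 2) / N) atTop (𝓝 0) := by
  have hlog := tendsto_log_natCast_atTop.eventually_gt_atTop 0
  have h1 : Tendsto (fun N : ℕ => ((n N : ℝ) * Real.log N / N) *
      (Real.log (ε N)⁻¹ / Real.log N)) atTop (𝓝 0) := by
    rcases hrate with h | ⟨rfl, η, -, hη⟩
    · simpa using hα.mul h
    · have h2 : Tendsto (fun N : ℕ => Real.log (ε N)⁻¹ / Real.log N) atTop (𝓝 η) := by
        refine tendsto_const_nhds.congr' ?_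
        filter_upwards [hlog, eventually_ge_atTop 1] with N hN hN1
        have : (0 : ℝ) < N := by exact_mod_cast hN1
        rw [hη N hN1, Real.log_inv, Real.log_rpow this]
        field_simp
      simpa using hα.mul h2
  have h2 := ((tendsto_div_of_tendsto_mul_log_div hα).mul_const (Real.log 2)).add
    (h1.const_mul 2)
  rw [zero_mul, mul_zero, add_zero] at h2
  refine squeeze_zero' (Eventually.of_forall fun N => ?_) ?_ h2
  · have := Real.log_nonneg (x := 1 + ((ε N)⁻¹) ^ 2) (by have := sq_nonneg (ε N)⁻¹; linarith)
    positivity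
  · filter_upwards [hlog, eventually_ge_atTop 1, hε.eventually_lt_const one_pos]
      with N hN hN1 hε1
    have hε0 := hε_pos N hN1
    have hN0 : (0 : ℝ) < N := by exact_mod_cast hN1
    have hinv : 1 ≤ (ε N)⁻¹ := one_le_inv₀ hε0 |>.2 hε1.le
    have h3 : Real.log (1 + ((ε N)⁻¹) ^ 2) ≤ Real.log 2 + 2 * Real.log (ε N)⁻¹ := by
      have h4 : 2 * Real.log (ε N)⁻¹ = Real.log ((ε N)⁻¹ ^ 2) := by
        rw [Real.log_pow]; norm_num
      rw [h4, ← Real.log_mul two_ne_zero (by positivity)]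
      apply Real.log_le_log (by positivity)
      nlinarith
    calc (n N : ℝ) * Real.log (1 + ((ε N)⁻¹) ^ 2) / N
        ≤ (n N : ℝ) * (Real.log 2 + 2 * Real.log (ε N)⁻¹) / N := by gcongr
      _ = _ := by field_simp

end Asymptotics

end NoisyLogDet

/-! ### Proof of the theorem -/

open NoisyLogDet

theorem theorem2p1 {Ω : Type*} [MeasurableSpace Ω] (P : Measure Ω) [IsProbabilityMeasure P]
    (γ : ℝ) (hγ : 1 / 2 < γ) (z : ℂ)
    (M : ∀ N : ℕ, Matrix (Fin N) (Fin N) ℂ)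
    (G : ∀ N : ℕ, Ω → Matrix (Fin N) (Fin N) ℂ) (hG : ∀ N, NoisyLogDet.IsGinibre P (G N))
    (A : ∀ N : ℕ, Matrix (Fin N) (Fin N) ℂ) (hA : ∀ N, A N = M N - z • 1)
    (ε : ℕ → ℝ) (hε_pos : ∀ N, 1 ≤ N → 0 < ε N) (hε : Tendsto ε atTop (𝓝 0))
    -- the value given to `N*` when no singular value is below its threshold
    (d : ℕ)
    (hd : d = 0 ∨ (d = 1 ∧
      Tendsto (fun N : ℕ => Real.posLog (NoisyLogDet.sigmaUp (A N) 1) / N) atTop (𝓝 0)))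
    (Nstar : ℕ → ℕ) (hNstar : ∀ N, Nstar N = NoisyLogDet.truncIndex (A N) γ (ε N) d)
    (α : ℝ) (hα : Tendsto (fun N : ℕ => (Nstar N : ℝ) * Real.log N / N) atTop (𝓝 α))
    (hrate : Tendsto (fun N : ℕ => Real.log (ε N)⁻¹ / Real.log N) atTop (𝓝 0) ∨
      (α = 0 ∧ ∃ η : ℝ, 0 < η ∧ ∀ N : ℕ, 1 ≤ N → ε N = (N : ℝ) ^ (-η))) :
    (∀ N, (NoisyLogDet.largeBlock (A N) (Nstar N)).det ≠ 0) ∧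
    (∀ N, ∀ᵐ ω ∂P, (NoisyLogDet.noisySigma (A N) γ (G N ω)).det ≠ 0) ∧
    TendstoInMeasure P
      (fun (N : ℕ) ω =>
        1 / (N : ℝ) * Real.log ‖(NoisyLogDet.noisySigma (A N) γ (G N ω)).det‖ -
          1 / (N : ℝ) * Real.log ‖(NoisyLogDet.largeBlock (A N) (Nstar N)).det‖)
      atTop (fun _ => -α * (γ - 1 / 2)) := by
  have hd1 : d ≤ 1 := by rcases hd with h | h <;> omega
  have hpos : ∀ N i, Nstar N ≤ i → i < N → 0 < sigmaUp (A N) (i + 1) := by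
    intro N i hi hiN
    exact sigmaUp_pos_of_truncIndex_le (A N) γ (hε_pos N (by omega)) d (hNstar N ▸ hi) hiN
  have hspos : ∀ N : ℕ, 1 ≤ N → 0 < (N : ℝ) ^ (-γ) := fun N hN =>
    Real.rpow_pos_of_pos (by exact_mod_cast hN) _
  have hlaw := fun N => (hG N).hasLaw_ginibreLaw
  set L : ℕ → ℝ := fun N => ∑ i ∈ Finset.Ico (Nstar N) N, Real.log (sigmaUp (A N) (i + 1))
    with hL
  have hprod : ∀ N, 0 < ∏ i ∈ Finset.Ico (Nstar N) N, sigmaUp (A N) (i + 1) := fun N =>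
    Finset.prod_pos fun i hi => hpos N i (Finset.mem_Ico.1 hi).1 (Finset.mem_Ico.1 hi).2
  have hdet : ∀ N, Real.log ‖(largeBlock (A N) (Nstar N)).det‖ = L N := by
    intro N
    rw [det_largeBlock, Complex.norm_real, Real.norm_of_nonneg (hprod N).le, Real.log_prod
      fun i hi => (hpos N i (Finset.mem_Ico.1 hi).1 (Finset.mem_Ico.1 hi).2).ne']
  refine ⟨fun N => ?_, fun N => ?_, ?_⟩
  · rw [det_largeBlock]
    exact_mod_cast (hprod N).ne'
  · rcases Nat.eq_zero_or_pos N with rfl | hN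
    · exact ae_of_all _ fun ω => by simp
    · have h1 := ae_det_perturbed_ne_zero (hspos N hN)
        (diagMatrix (fun i => sigmaUp (A N) (i + 1)) N)
      rw [← (hlaw N).map_eq] at h1
      exact ae_of_ae_map (hlaw N).aemeasurable h1
  -- the normalised difference as a function of the Gaussian entries
  set F : ∀ N : ℕ, (Fin N → Fin N → ℂ) → ℝ := fun N g => 1 / (N : ℝ) * Real.log
    ‖(perturbed (diagMatrix (fun i => sigmaUp (A N) (i + 1)) N) ((N : ℝ) ^ (-γ)) g).det‖ -
      1 / (N : ℝ) * L N with hF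
  have hFm : ∀ N, Measurable (F N) := fun N =>
    ((Real.measurable_log.comp (measurable_det_perturbed _ _).norm).const_mul _).sub_const _
  set c := -α * (γ - 1 / 2) with hc
  -- `V / 2` is the upper centre from the second moment and `U` the lower bound for the mean, both
  -- relative to $\log\det B$.
  set V : ℕ → ℝ := fun N => momentExponent (A N) γ (ε N) d (Nstar N) with hV
  set U : ℕ → ℝ := fun N => Nstar N * (-γ * Real.log N) +
    1 / 2 * (Nstar N * Real.log (Nstar N) - Nstar N) - Nstar N * negLogBound with hU
  -- Concentration holds around $V/(2N)$; the last term is the cost of moving the centre to the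
  -- limit `c`.
  have hbound : ∀ N, 1 ≤ N → Integrable (F N) (ginibreLaw N) ∧
      ∫ g, |F N g - c| ∂(ginibreLaw N) ≤
        (1 / (N : ℝ) + V N / N / 2 - U N / N) + |V N / N / 2 - c| := by
    intro N hN
    have hN0 : (0 : ℝ) < N := by exact_mod_cast hN
    have hlogs : Real.log ((N : ℝ) ^ (-γ)) = -γ * Real.log N := Real.log_rpow hN0 _
    have hI := integrable_log_norm_det_perturbed (hspos N hN)
      (diagMatrix (fun i => sigmaUp (A N) (i + 1)) N)
    have hIF : Integrable (F N) (ginibreLaw N) := (hI.const_mul _).sub (integrable_const _)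
    refine ⟨hIF, ?_⟩
    have h1 := integral_abs_log_norm_det_sub_le (hspos N hN)
      (fun i => sigmaUp (A N) (i + 1)) (n := Nstar N) (m := N)
      (hNstar N ▸ truncIndex_le (A N) γ (ε N) hd1 hN) (hpos N) (V := V N)
      (by simpa only [hV, hNstar N] using
        prod_le_exp_momentExponent (A N) hγ (hε_pos N hN) hd1 hN)
    rw [hlogs] at h1
    have h2 : ∀ g, |F N g - c| ≤ 1 / (N : ℝ) * |Real.log ‖(perturbed (diagMatrix
        (fun i => sigmaUp (A N) (i + 1)) N) ((N : ℝ) ^ (-γ)) g).det‖ - L N - V N / 2| +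
        |V N / N / 2 - c| := by
      intro g
      have h3 : F N g - c = 1 / (N : ℝ) * (Real.log ‖(perturbed (diagMatrix
        (fun i => sigmaUp (A N) (i + 1)) N) ((N : ℝ) ^ (-γ)) g).det‖ - L N - V N / 2) +
        (V N / N / 2 - c) := by
        simp only [hF]
        ring
      rw [h3]
      refine (abs_add_le _ _).trans (le_of_eq ?_)
      rw [abs_mul, abs_of_pos (one_div_pos.2 hN0)]
    have hI2 : Integrable (fun g => 1 / (N : ℝ) * |Real.log ‖(perturbed (diagMatrix
        (fun i => sigmaUp (A N) (i + 1)) N) ((N : ℝ) ^ (-γ)) g).det‖ - L N - V N / 2|)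
        (ginibreLaw N) :=
      (((hI.sub (integrable_const _)).sub (integrable_const _)).abs).const_mul _
    refine (integral_mono (hIF.sub (integrable_const c)).abs
      (hI2.add (integrable_const _)) h2).trans ?_
    rw [integral_add' hI2 (integrable_const _), integral_const_mul]
    simp only [integral_const, probReal_univ, one_smul]
    gcongr
    refine (mul_le_mul_of_nonneg_left h1 (one_div_pos.2 hN0).le).trans (le_of_eq ?_)
    simp only [hU]
    ring
  have hn0 := tendsto_div_of_tendsto_mul_log_div hα
  have hinv : Tendsto (fun N : ℕ => 1 / (N : ℝ)) atTop (𝓝 0) := tendsto_one_div_atTop_nhds_zero_nat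
  have hVlim : Tendsto (fun N => V N / N / 2) atTop (𝓝 c) := by
    have hpl : Tendsto (fun N : ℕ => (d : ℝ) * (Real.posLog (sigmaUp (A N) 1) / N)) atTop
        (𝓝 0) := by
      rcases hd with rfl | ⟨rfl, h⟩
      · simp
      · simpa using h
    have h1 := ((((hα.const_mul (1 - 2 * γ)).add
      (tendsto_mul_log_one_add_div hε_pos hε hα hrate)).add
      (((hpl.const_mul 2).add (hinv.const_mul (d * Real.log 2))).sub
        (tendsto_log_natCast_div.const_mul (d * (1 - 2 * γ))))).add (hε.pow 2)).div_const 2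
    have h2 : ((1 - 2 * γ) * α + 0 + (2 * 0 + d * Real.log 2 * 0 - d * (1 - 2 * γ) * 0) +
        0 ^ 2) / 2 = c := by
      rw [hc]; ring
    rw [h2] at h1
    refine h1.congr' ?_
    filter_upwards [eventually_ge_atTop 1] with N hN
    have hN0 : (N : ℝ) ≠ 0 := by positivity
    simp only [hV, momentExponent]
    field_simp
  -- The factorial supplies $+\frac12\alpha$ against $-\gamma\alpha$ from $n\log s$, so the lower
  -- bound meets the upper one at `c`.
  have hUlim : Tendsto (fun N => U N / N) atTop (𝓝 c) := by
    have h1 := ((hα.const_mul (-γ)).add (((tendsto_mul_log_self_div hα).sub hn0).const_mul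
      (1 / 2))).sub (hn0.mul_const negLogBound)
    have h2 : -γ * α + 1 / 2 * (α - 0) - 0 * negLogBound = c := by
      rw [hc]; ring
    rw [h2] at h1
    refine h1.congr fun N => ?_
    simp only [hU]
    ring
  have hlim : Tendsto (fun N : ℕ => (1 / (N : ℝ) + V N / N / 2 - U N / N) + |V N / N / 2 - c|)
      atTop (𝓝 0) := by
    have h1 := ((hinv.add hVlim).sub hUlim).add (hVlim.sub_const c).abs
    simpa using h1
  have hgoal : (fun (N : ℕ) ω => 1 / (N : ℝ) * Real.log ‖(noisySigma (A N) γ (G N ω)).det‖ -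
      1 / (N : ℝ) * Real.log ‖(largeBlock (A N) (Nstar N)).det‖) =
      fun (N : ℕ) ω => F N fun i j => G N ω i j := by
    funext N ω
    rw [hdet]
    rfl
  rw [hgoal]
  -- Convergence in $L^1$ implies convergence in probability; the $L^1$ norm is computed under
  -- `ginibreLaw N`.
  refine tendstoInMeasure_of_tendsto_eLpNorm one_ne_zero (fun N =>
    ((hFm N).comp_aemeasurable (hlaw N).aemeasurable).aestronglyMeasurable)
    aestronglyMeasurable_const ?_
  have hlim' := ENNReal.tendsto_ofReal hlim
  rw [ENNReal.ofReal_zero] at hlim'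
  refine tendsto_of_tendsto_of_tendsto_of_le_of_le' tendsto_const_nhds hlim'
    (Eventually.of_forall fun N => zero_le) ?_
  filter_upwards [eventually_ge_atTop 1] with N hN
  obtain ⟨hIF, hle⟩ := hbound N hN
  have hm : Measurable fun g => F N g - c := (hFm N).sub_const c
  rw [eLpNorm_one_eq_lintegral_enorm]
  have h1 : ∫⁻ ω, ‖(F N fun i j => G N ω i j) - c‖ₑ ∂P =
      ∫⁻ g, ‖F N g - c‖ₑ ∂(ginibreLaw N) := by
    rw [← (hlaw N).map_eq, lintegral_map' hm.enorm.aemeasurable (hlaw N).aemeasurable]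
  refine h1.le.trans ?_
  have h2 : Integrable (fun g => F N g - c) (ginibreLaw N) := hIF.sub (integrable_const c)
  rw [← ofReal_integral_norm_eq_lintegral_enorm h2]
  exact ENNReal.ofReal_le_ofReal hle
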